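/- **Setting.** Consider $n$ spins $V=\{0,\dots,n-1\}$, each with local Hilbert space $\mathbb C^d$. Let $S$ be a finite set of subsystems $X\subseteq V$ and, for each $X\in S$, let $h_X$ be a Hermitian operator on $(\mathbb C^d)^{\otimes n}$ with support exactly $X$ and operator norm $\|h_X\|=1$. For real coefficients $\lambda=(\lambda_X)_{X\in S}$ put $H=\sum_{X\in S}\lambda_X h_X$. Assume that $|X|\le k$ for all $X\in S$, and that the interaction graph (vertex set $S$, distinct $X,Y$ adjacent iff $X\cap Y\ne\emptyset$) has maximum degree at most $\mathfrak d$. Let $\rho=\bigotimes_{v\in V}\rho_v$ be a product state (each $\rho_v$ a $d\times d$ density matrix), let $t\in\mathbb C$, and let $L(t)=\mathrm{tr}(e^{-iHt}\rho)$ be the Loschmidt echo, regarded as a function of $\lambda$. A cluster $\mathbf W$ of size $m$ is a nonempty multiset of $m$ elements of $S$ (counted with multiplicity $\mu_{\mathbf W}$). It is connected if the graph whose vertices are the $m$ members of $\mathbf W$ (repeated subsystems being repeated vertices), with distinct vertices adjacent iff the subsystems intersect, is connected. Its cluster derivative is $$\mathcal D_{\mathbf W}f=\Big[\prod_{X\in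 S}\Big(\frac{\partial}{\partial\lambda_X}\Big)^{\mu_{\mathbf W}(X)}f(\lambda)\Big]_{\lambda=0}.$$ **Model of computation.** Exact complex arithmetic, so that issues of finite numerical precision are ignored: programs in a deterministic first-order functional language with recursion, over binary trees with complex numbers at the leaves, where every elementary operation (variable access, pairing and unpairing, $+,-,\times,\div$, equality test of numbers, binding, function call) costs one unit of time and the only constants are $0,1,i$. The input for a cluster $\mathbf W$, listed in any order as $W_1,\dots,W_m$, consists of $t$, of the list of the spins in $\bigcup_j W_j$ with their density matrices $\rho_v$, and of the list of the $W_j$, each with the list of its spins and the matrix entries of $h_{W_j}$ as an operator on the spins of $W_j$. **Proposition.** There exists a deterministic algorithm that, for every connected cluster $\mathbf W$ of size $m$, outputs $\mathcal D_{\mathbf W}\log L(t)$ with running time $\exp(\mathcal O(m))$. That is, there is a single program such that for all $d,k,\mathfrak d$ there is a constant $C$, depending only on $d,k,\mathfrak d$, such that for all $n$, $S$, $(h_X)_{X\in S}$, $\rho$, $t$ as above, all $m$ and all connected clusters $\mathbf W$ of size $m$, the program run on the input for $\mathbf W$ halts after at most $e^{Cm}$ time units with output $\mathcal D_{\mathbf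 W}\log L(t)$. -/

import Mathlib

/-! ### Computation with exact complex arithmetic

The model of computation is a deterministic first-order functional language over binary trees whose
leaves are complex numbers or `nil`.  Every elementary operation (reading a variable, building or
taking apart a pair, an exact field operation on two numbers, an equality test of two numbers, a
binding, a function call) costs one time unit. Numbers can be inspected by equality tests only; the
only literals are `0`, `1` and `i`. -/

/-- Data: numbers, the empty list, and pairs. -/
inductive Val : Type
  | nil : Val
  | num (z : ℂ) : Val
  | cons (u v : Val) : Val

/-- A list of data, as data. -/
def Val.ofList (l : List Val) : Val := l.foldr Val.cons Val.nil

/-- Expressions. `var i` is the `i`-th most recently bound variable; functions are unary and are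
referred to by their index in the program. -/
inductive Expr : Type
  | var (i : ℕ) : Expr
  | nil : Expr
  | zero : Expr
  | one : Expr
  | imag : Expr
  | add (e₁ e₂ : Expr) : Expr
  | sub (e₁ e₂ : Expr) : Expr
  | mul (e₁ e₂ : Expr) : Expr
  | div (e₁ e₂ : Expr) : Expr
  | cons (e₁ e₂ : Expr) : Expr
  | head (e : Expr) : Expr
  | tail (e : Expr) : Expr
  /-- if the numbers `e₁` and `e₂` are equal then `e₃` else `e₄` -/
  | ifEq (e₁ e₂ e₃ e₄ : Expr) : Expr
  /-- if `e₁` is a pair then `e₂` else `e₃` -/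
  | ifCons (e₁ e₂ e₃ : Expr) : Expr
  /-- evaluate `e₁`, bind the result to variable `0`, evaluate `e₂` -/
  | bind (e₁ e₂ : Expr) : Expr
  /-- apply function number `f` to `e` -/
  | call (f : ℕ) (e : Expr) : Expr

/-- A program is a finite list of (mutually recursive) function bodies, in which variable `0` is
the argument. The main function is number `0`. -/
abbrev Program := List Expr

/-- `Eval P env e v c`: in the program `P`, with the variables bound to `env`, the expression `e`
evaluates to `v` in exactly `c` time units. There is no result on a type error, a division by zero,
or a computation that does not terminate. -/
inductive Eval (P : Program) : List Val → Expr → Val → ℕ → Prop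
  | var {env : List Val} {i : ℕ} {v : Val} (h : env[i]? = some v) : Eval P env (.var i) v 1
  | nil {env : List Val} : Eval P env .nil .nil 1
  | zero {env : List Val} : Eval P env .zero (.num 0) 1
  | one {env : List Val} : Eval P env .one (.num 1) 1
  | imag {env : List Val} : Eval P env .imag (.num Complex.I) 1
  | add {env : List Val} {e₁ e₂ : Expr} {x y : ℂ} {a b : ℕ}
      (h₁ : Eval P env e₁ (.num x) a) (h₂ : Eval P env e₂ (.num y) b) :
      Eval P env (.add e₁ e₂) (.num (x + y)) (a + b + 1)
  | sub {env : List Val} {e₁ e₂ : Expr} {x y : ℂ} {a b : ℕ}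
      (h₁ : Eval P env e₁ (.num x) a) (h₂ : Eval P env e₂ (.num y) b) :
      Eval P env (.sub e₁ e₂) (.num (x - y)) (a + b + 1)
  | mul {env : List Val} {e₁ e₂ : Expr} {x y : ℂ} {a b : ℕ}
      (h₁ : Eval P env e₁ (.num x) a) (h₂ : Eval P env e₂ (.num y) b) :
      Eval P env (.mul e₁ e₂) (.num (x * y)) (a + b + 1)
  | div {env : List Val} {e₁ e₂ : Expr} {x y : ℂ} {a b : ℕ}
      (h₁ : Eval P env e₁ (.num x) a) (h₂ : Eval P env e₂ (.num y) b) (hy : y ≠ 0) :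
      Eval P env (.div e₁ e₂) (.num (x / y)) (a + b + 1)
  | cons {env : List Val} {e₁ e₂ : Expr} {u v : Val} {a b : ℕ}
      (h₁ : Eval P env e₁ u a) (h₂ : Eval P env e₂ v b) :
      Eval P env (.cons e₁ e₂) (.cons u v) (a + b + 1)
  | head {env : List Val} {e : Expr} {u v : Val} {a : ℕ}
      (h : Eval P env e (.cons u v) a) : Eval P env (.head e) u (a + 1)
  | tail {env : List Val} {e : Expr} {u v : Val} {a : ℕ}
      (h : Eval P env e (.cons u v) a) : Eval P env (.tail e) v (a + 1)
  | ifEq_true {env : List Val} {e₁ e₂ e₃ e₄ : Expr} {x y : ℂ} {v : Val} {a b c : ℕ}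
      (h₁ : Eval P env e₁ (.num x) a) (h₂ : Eval P env e₂ (.num y) b) (hxy : x = y)
      (h₃ : Eval P env e₃ v c) : Eval P env (.ifEq e₁ e₂ e₃ e₄) v (a + b + c + 1)
  | ifEq_false {env : List Val} {e₁ e₂ e₃ e₄ : Expr} {x y : ℂ} {v : Val} {a b c : ℕ}
      (h₁ : Eval P env e₁ (.num x) a) (h₂ : Eval P env e₂ (.num y) b) (hxy : x ≠ y)
      (h₄ : Eval P env e₄ v c) : Eval P env (.ifEq e₁ e₂ e₃ e₄) v (a + b + c + 1)
  | ifCons_cons {env : List Val} {e₁ e₂ e₃ : Expr} {u w v : Val} {a b : ℕ}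
      (h₁ : Eval P env e₁ (.cons u w) a) (h₂ : Eval P env e₂ v b) :
      Eval P env (.ifCons e₁ e₂ e₃) v (a + b + 1)
  | ifCons_nil {env : List Val} {e₁ e₂ e₃ : Expr} {v : Val} {a b : ℕ}
      (h₁ : Eval P env e₁ .nil a) (h₃ : Eval P env e₃ v b) :
      Eval P env (.ifCons e₁ e₂ e₃) v (a + b + 1)
  | ifCons_num {env : List Val} {e₁ e₂ e₃ : Expr} {x : ℂ} {v : Val} {a b : ℕ}
      (h₁ : Eval P env e₁ (.num x) a) (h₃ : Eval P env e₃ v b) :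
      Eval P env (.ifCons e₁ e₂ e₃) v (a + b + 1)
  | bind {env : List Val} {e₁ e₂ : Expr} {u v : Val} {a b : ℕ}
      (h₁ : Eval P env e₁ u a) (h₂ : Eval P (u :: env) e₂ v b) :
      Eval P env (.bind e₁ e₂) v (a + b + 1)
  | call {env : List Val} {f : ℕ} {e body : Expr} {u v : Val} {a b : ℕ}
      (h₁ : Eval P env e u a) (hf : P[f]? = some body) (h₂ : Eval P [u] body v b) :
      Eval P env (.call f e) v (a + b + 1)

/-- Computations are deterministic: result and running time are determined by the input. -/
theorem Eval.deterministic {P : Program} {env : List Val} {e : Expr} {v v' : Val} {c c' : ℕ}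
    (h : Eval P env e v c) (h' : Eval P env e v' c') : v = v' ∧ c = c' := by
  induction h generalizing v' c' <;> cases h' <;> grind

/-- On the given input the program halts with the given output, after at most `T` time units. -/
def Program.OutputsWithin (P : Program) (input output : Val) (T : ℝ) : Prop :=
  ∃ c : ℕ, Eval P [input] (.call 0 (.var 0)) output c ∧ (c : ℝ) ≤ T

/-! ### Spin systems

There are `n` spins of local dimension `d`. Operators on `⨂ᵥ ℂᵈ` are matrices indexed by the
configurations `Fin n → Fin d` of the product basis. -/

/-- Operators on the Hilbert space of `n` spins of dimension `d`. -/
abbrev SpinOp (n d : ℕ) := Matrix (Fin n → Fin d) (Fin n → Fin d) ℂ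

/-- `A ⊗ 1`, where `A` acts on the spins in `X`. The `j`-th tensor factor of `A` is the `j`-th
smallest element of `X`. -/
def embedOp {n d : ℕ} (X : Finset (Fin n))
    (A : Matrix (Fin X.card → Fin d) (Fin X.card → Fin d) ℂ) : SpinOp n d :=
  fun a b =>
    if ∀ v, v ∉ X → a v = b v then
      A (fun j => a (X.orderEmbOfFin rfl j)) (fun j => b (X.orderEmbOfFin rfl j))
    else 0

/-- `A` acts as the identity outside of `X`. -/
def ActsOn {n d : ℕ} (A : SpinOp n d) (X : Finset (Fin n)) : Prop :=
  ∃ B : Matrix (Fin X.card → Fin d) (Fin X.card → Fin d) ℂ, A = embedOp X B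

/-- `supp A = X`: the smallest set of spins on which `A` acts nontrivially is `X`. -/
def HasSupport {n d : ℕ} (A : SpinOp n d) (X : Finset (Fin n)) : Prop :=
  ActsOn A X ∧ ∀ Y : Finset (Fin n), ActsOn A Y → X ⊆ Y

/-- The terms of a Hamiltonian `∑_{X ∈ S} λ_X h_X`: a finite set `S` of subsystems and, for each
`X ∈ S`, a Hermitian operator `h_X` with support `X` and operator norm `1`. -/
structure Hamiltonian (n d : ℕ) where
  S : Finset (Finset (Fin n))
  /-- `h_X` as a matrix on the spins of `X`. -/
  term : (X : S) → Matrix (Fin X.1.card → Fin d) (Fin X.1.card → Fin d) ℂ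
  hermitian : ∀ X : S, (term X).IsHermitian
  support : ∀ X : S, HasSupport (embedOp X.1 (term X)) X.1
  norm_eq_one : ∀ X : S, ‖Matrix.toEuclideanCLM (𝕜 := ℂ) (embedOp X.1 (term X))‖ = 1

namespace Hamiltonian

variable {n d : ℕ}

/-- Every term acts on at most `k` spins. -/
def IsLocal (H : Hamiltonian n d) (k : ℕ) : Prop := ∀ X ∈ H.S, X.card ≤ k

/-- The interaction graph: distinct subsystems are adjacent iff they overlap. -/
def interactionGraph (H : Hamiltonian n d) : SimpleGraph H.S where
  Adj X Y := X ≠ Y ∧ (X.1 ∩ Y.1).Nonempty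
  symm := ⟨fun _ _ h => ⟨h.1.symm, by rw [Finset.inter_comm]; exact h.2⟩⟩
  loopless := ⟨fun _ h => h.1 rfl⟩

/-- The maximum degree of the interaction graph is at most `D`. -/
def DegreeLE (H : Hamiltonian n d) (D : ℕ) : Prop :=
  ∀ X : H.S, (H.interactionGraph.neighborSet X).ncard ≤ D

/-- The Hamiltonian `∑_{X ∈ S} λ_X h_X` as a function of the real coefficients. -/
noncomputable def op (H : Hamiltonian n d) (lam : H.S → ℝ) : SpinOp n d :=
  ∑ X : H.S, (lam X : ℂ) • embedOp X.1 (H.term X)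

/-- The cluster graph of a multiset of subsystems, in which repeated subsystems are repeated
vertices: distinct vertices are adjacent iff their subsystems overlap. -/
def clusterGraph (H : Hamiltonian n d) (W : Multiset H.S) : SimpleGraph W.ToType where
  Adj p q := p ≠ q ∧ (p.1.1 ∩ q.1.1).Nonempty
  symm := ⟨fun _ _ h => ⟨h.1.symm, by rw [Finset.inter_comm]; exact h.2⟩⟩
  loopless := ⟨fun _ h => h.1 rfl⟩

/-- The connected clusters of size `m`. -/
def connectedClusters (H : Hamiltonian n d) (m : ℕ) : Set (Multiset H.S) :=
  {W | W ≠ 0 ∧ Multiset.card W = m ∧ (H.clusterGraph W).Connected}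

end Hamiltonian

open scoped ComplexOrder in
/-- A product state `⨂ᵥ ρᵥ`, given by a density matrix for each spin. -/
structure ProductState (n d : ℕ) where
  site : Fin n → Matrix (Fin d) (Fin d) ℂ
  posSemidef : ∀ v, (site v).PosSemidef
  trace_eq_one : ∀ v, (site v).trace = 1

/-- The density matrix `⨂ᵥ ρᵥ`. -/
noncomputable def ProductState.op {n d : ℕ} (ρ : ProductState n d) : SpinOp n d :=
  fun a b => ∏ v, ρ.site v (a v) (b v)

/-- The Loschmidt echo `L(t) = tr (exp (-i H t) ρ)` as a function of the coefficients of `H`. -/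
noncomputable def loschmidtEcho {n d : ℕ} (H : Hamiltonian n d) (ρ : ProductState n d) (t : ℂ)
    (lam : H.S → ℝ) : ℂ :=
  (NormedSpace.exp (-(Complex.I * t) • H.op lam) * ρ.op).trace

/-- The partial derivative `∂f/∂x_i`. -/
noncomputable def partialDeriv {ι : Type*} [DecidableEq ι] (i : ι) (f : (ι → ℝ) → ℂ) :
    (ι → ℝ) → ℂ :=
  fun x => deriv (fun s : ℝ => f (Function.update x i s)) (x i)

/-- The cluster derivative: all the partial derivatives listed in the multiset `W`, one after the
other, evaluated at the origin. The order in which they are taken is immaterial for functions that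
are smooth near the origin. -/
noncomputable def clusterDeriv {ι : Type*} [DecidableEq ι] (W : Multiset ι)
    (f : (ι → ℝ) → ℂ) : ℂ :=
  W.toList.foldr partialDeriv f 0

/-! ### The input of the algorithm -/

/-- A matrix, as the list of its rows. -/
def encodeMatrix {d : ℕ} (A : Matrix (Fin d) (Fin d) ℂ) : Val :=
  Val.ofList (List.ofFn fun i => Val.ofList (List.ofFn fun j => Val.num (A i j)))

/-- An operator on `r` spins as a nested array, with the indices in the order
`i₁, j₁, i₂, j₂, …, iᵣ, jᵣ` (`i` for rows, `j` for columns). -/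
def encodeOp {d : ℕ} : (r : ℕ) → ((Fin r → Fin d) → (Fin r → Fin d) → ℂ) → Val
  | 0, A => Val.num (A Fin.elim0 Fin.elim0)
  | r + 1, A => Val.ofList (List.ofFn fun i => Val.ofList (List.ofFn fun j =>
      encodeOp r fun a b => A (Fin.cons i a) (Fin.cons j b)))

/-- A spin, as a number. -/
def encodeSpin {n : ℕ} (v : Fin n) : Val := Val.num ((v : ℕ) : ℂ)

/-- The spins on which some member of the list acts, in increasing order. -/
def spinsOf {n d : ℕ} (H : Hamiltonian n d) (W : List H.S) : List (Fin n) :=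
  (W.toFinset.biUnion fun X => X.1).sort (· ≤ ·)

/-- The input for a cluster `W₁, …, W_m`: the time `t`; the spins on which the cluster acts, each
with its density matrix; the subsystems `W₁, …, W_m`, each as the list of its spins together with
its operator. -/
def encodeInput {n d : ℕ} (H : Hamiltonian n d) (ρ : ProductState n d) (t : ℂ) (W : List H.S) :
    Val :=
  Val.ofList
    [Val.num t,
     Val.ofList ((spinsOf H W).map fun v => Val.cons (encodeSpin v) (encodeMatrix (ρ.site v))),
     Val.ofList (W.map fun X =>
       Val.cons (Val.ofList ((X.1.sort (· ≤ ·)).map encodeSpin))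
         (encodeOp X.1.card (H.term X)))]

/-!
The cluster derivative is computed by arithmetic in the algebra `ℂ[x₁, …, x_m] / (x_i²)`, with one
variable for each member of the cluster. An element of this algebra is a binary tree of depth `m`,
and the jet of a function `f` (`jet`) is the tree of the values at `λ = 0` of the derivatives of `f`
with respect to the subfamilies of `W₁, …, W_m`. By the product rule, taking jets turns products and
quotients of functions into products and quotients of trees (`computes_mulJet`,
`computes_divJet`). As `∂ log L = ∂L / L` for the derivative with respect to the first variable, the
cluster derivative of `log L` is the top coefficient of a quotient of the two halves of the jet of
`L`.

The jet of `L(t) = tr (exp (-i t H) ρ)` comes from the jet of an operator-valued function.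
The operators in question are tensor products of an operator on the at most `k m` spins of the
cluster with the product state on the other spins, so they may be replaced by their partial traces
onto the spins of the cluster. These are nested arrays (`encT`) that can be multiplied by the terms
`h_X` (`computes_mul`). The Hamiltonian vanishes at `λ = 0`, hence its powers beyond the `m`-th do not
contribute to the jet, and Horner's scheme for the truncated exponential series is exact on jets
(`computes_horner`, `vanishesToOrder_sub_hornerSum`).

For the running time it is enough to bound the depth of nested function calls: a call makes a number
of further calls that is bounded in terms of the program only, so the time is exponential in the
depth (`exists_eval_of_callFn_eq_some`). All the functions of the program recurse along lists of
length `d`, along the spins of the cluster, or along the members of the cluster, so the depth is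
`O(m)`. This replaces all bookkeeping of costs: evaluation is modelled by an interpreter `callFn`
with a bound on the depth, and each function of the program is specified by `Computes`.
-/

namespace ClusterAlgorithm

/-! ### A depth-bounded interpreter -/

/-- The number of nodes of an expression. -/
def size : Expr → ℕ
  | .var _ | .nil | .zero | .one | .imag => 1
  | .add a b | .sub a b | .mul a b | .div a b | .cons a b | .bind a b => size a + size b + 1
  | .head a | .tail a | .call _ a => size a + 1
  | .ifEq a b c d => size a + size b + size c + size d + 1
  | .ifCons a b c => size a + size b + size c + 1

open Classical in
/-- The value of an expression, when the results of function calls are given by `call`. -/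
noncomputable def eval (call : ℕ → Val → Option Val) : List Val → Expr → Option Val
  | env, .var i => env[i]?
  | _, .nil => some .nil
  | _, .zero => some (.num 0)
  | _, .one => some (.num 1)
  | _, .imag => some (.num Complex.I)
  | env, .add a b =>
    match eval call env a, eval call env b with
    | some (.num x), some (.num y) => some (.num (x + y))
    | _, _ => none
  | env, .sub a b =>
    match eval call env a, eval call env b with
    | some (.num x), some (.num y) => some (.num (x - y))
    | _, _ => none
  | env, .mul a b =>
    match eval call env a, eval call env b with
    | some (.num x), some (.num y) => some (.num (x * y))
    | _, _ => none
  | env, .div a b =>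
    match eval call env a, eval call env b with
    | some (.num x), some (.num y) => if y = 0 then none else some (.num (x / y))
    | _, _ => none
  | env, .cons a b =>
    match eval call env a, eval call env b with
    | some u, some v => some (.cons u v)
    | _, _ => none
  | env, .head a =>
    match eval call env a with
    | some (.cons u _) => some u
    | _ => none
  | env, .tail a =>
    match eval call env a with
    | some (.cons _ v) => some v
    | _ => none
  | env, .ifEq a b c d =>
    match eval call env a, eval call env b with
    | some (.num x), some (.num y) => if x = y then eval call env c else eval call env d
    | _, _ => none
  | env, .ifCons a b c =>
    match eval call env a with
    | some (.cons _ _) => eval call env b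
    | some _ => eval call env c
    | none => none
  | env, .bind a b =>
    match eval call env a with
    | some u => eval call (u :: env) b
    | none => none
  | env, .call f a =>
    match eval call env a with
    | some u => call f u
    | none => none

/-- The result of calling function `f` of the program `P`, if calls are nested at most `N` deep. -/
noncomputable def callFn (P : Program) : ℕ → ℕ → Val → Option Val
  | 0, _, _ => none
  | N + 1, f, u =>
    match P[f]? with
    | some body => eval (callFn P N) [u] body
    | none => none

/-- One level of calls: if calls cost at most `B - 1` time units, then so does each node of an
expression up to a factor `B`. -/
theorem exists_eval_of_eval_eq_some {P : Program} {call : ℕ → Val → Option Val} {B : ℕ}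
    (hB : 1 ≤ B)
    (hcall : ∀ f u v, call f u = some v →
      ∃ body c, P[f]? = some body ∧ Eval P [u] body v c ∧ c + 1 ≤ B) :
    ∀ (e : Expr) (env : List Val) (v : Val), eval call env e = some v →
      ∃ c, Eval P env e v c ∧ c ≤ size e * B := by
  intro e
  induction e with
  | var i => intro env v h; exact ⟨1, .var h, by simpa [size] using hB⟩
  | nil => intro env v h; cases h; exact ⟨1, .nil, by simpa [size] using hB⟩
  | zero => intro env v h; cases h; exact ⟨1, .zero, by simpa [size] using hB⟩
  | one => intro env v h; cases h; exact ⟨1, .one, by simpa [size] using hB⟩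
  | imag => intro env v h; cases h; exact ⟨1, .imag, by simpa [size] using hB⟩
  | add a b iha ihb =>
    intro env v h
    simp only [eval] at h
    split at h <;> cases h
    next x y h1 h2 =>
      obtain ⟨c1, e1, l1⟩ := iha _ _ h1
      obtain ⟨c2, e2, l2⟩ := ihb _ _ h2
      exact ⟨_, .add e1 e2, by simp only [size, add_mul]; omega⟩
  | sub a b iha ihb =>
    intro env v h
    simp only [eval] at h
    split at h <;> cases h
    next x y h1 h2 =>
      obtain ⟨c1, e1, l1⟩ := iha _ _ h1
      obtain ⟨c2, e2, l2⟩ := ihb _ _ h2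
      exact ⟨_, .sub e1 e2, by simp only [size, add_mul]; omega⟩
  | mul a b iha ihb =>
    intro env v h
    simp only [eval] at h
    split at h <;> cases h
    next x y h1 h2 =>
      obtain ⟨c1, e1, l1⟩ := iha _ _ h1
      obtain ⟨c2, e2, l2⟩ := ihb _ _ h2
      exact ⟨_, .mul e1 e2, by simp only [size, add_mul]; omega⟩
  | div a b iha ihb =>
    intro env v h
    simp only [eval] at h
    split at h
    next x y h1 h2 =>
      split at h
      · cases h
      next hy =>
        cases h
        obtain ⟨c1, e1, l1⟩ := iha _ _ h1
        obtain ⟨c2, e2, l2⟩ := ihb _ _ h2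
        exact ⟨_, .div e1 e2 hy, by simp only [size, add_mul]; omega⟩
    · cases h
  | cons a b iha ihb =>
    intro env v h
    simp only [eval] at h
    split at h <;> cases h
    next x y h1 h2 =>
      obtain ⟨c1, e1, l1⟩ := iha _ _ h1
      obtain ⟨c2, e2, l2⟩ := ihb _ _ h2
      exact ⟨_, .cons e1 e2, by simp only [size, add_mul]; omega⟩
  | head a iha =>
    intro env v h
    simp only [eval] at h
    split at h <;> cases h
    next x y h1 =>
      obtain ⟨c1, e1, l1⟩ := iha _ _ h1
      exact ⟨_, .head e1, by simp only [size, add_mul]; omega⟩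
  | tail a iha =>
    intro env v h
    simp only [eval] at h
    split at h <;> cases h
    next x y h1 =>
      obtain ⟨c1, e1, l1⟩ := iha _ _ h1
      exact ⟨_, .tail e1, by simp only [size, add_mul]; omega⟩
  | ifEq a b c d iha ihb ihc ihd =>
    intro env v h
    simp only [eval] at h
    split at h
    next x y h1 h2 =>
      obtain ⟨c1, e1, l1⟩ := iha _ _ h1
      obtain ⟨c2, e2, l2⟩ := ihb _ _ h2
      split at h
      next hxy =>
        obtain ⟨c3, e3, l3⟩ := ihc _ _ h
        exact ⟨_, .ifEq_true e1 e2 hxy e3, by simp only [size, add_mul]; omega⟩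
      next hxy =>
        obtain ⟨c3, e3, l3⟩ := ihd _ _ h
        exact ⟨_, .ifEq_false e1 e2 hxy e3, by simp only [size, add_mul]; omega⟩
    · cases h
  | ifCons a b c iha ihb ihc =>
    intro env v h
    simp only [eval] at h
    split at h
    next x y h1 =>
      obtain ⟨c1, e1, l1⟩ := iha _ _ h1
      obtain ⟨c2, e2, l2⟩ := ihb _ _ h
      exact ⟨_, .ifCons_cons e1 e2, by simp only [size, add_mul]; omega⟩
    next x hx h1 =>
      obtain ⟨c1, e1, l1⟩ := iha _ _ h1
      obtain ⟨c2, e2, l2⟩ := ihc _ _ h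
      cases x with
      | nil => exact ⟨_, .ifCons_nil e1 e2, by simp only [size, add_mul]; omega⟩
      | num z => exact ⟨_, .ifCons_num e1 e2, by simp only [size, add_mul]; omega⟩
      | cons u w => exact absurd rfl (hx u w)
    · cases h
  | bind a b iha ihb =>
    intro env v h
    simp only [eval] at h
    split at h
    next x h1 =>
      obtain ⟨c1, e1, l1⟩ := iha _ _ h1
      obtain ⟨c2, e2, l2⟩ := ihb _ _ h
      exact ⟨_, .bind e1 e2, by simp only [size, add_mul]; omega⟩
    · cases h
  | call f a iha =>
    intro env v h
    simp only [eval] at h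
    split at h
    next x h1 =>
      obtain ⟨c1, e1, l1⟩ := iha _ _ h1
      obtain ⟨body, c2, hf, e2, l2⟩ := hcall _ _ _ h
      exact ⟨_, .call e1 hf e2, by simp only [size, add_mul]; omega⟩
    · cases h

/-- A computation whose calls are nested at most `N` deep takes time exponential in `N`: every call
spawns a number of calls that is bounded in terms of the program only. -/
theorem exists_eval_of_callFn_eq_some {P : Program} {S : ℕ} (hS : ∀ body ∈ P, size body ≤ S) :
    ∀ (N f : ℕ) (u v : Val), callFn P N f u = some v →
      ∃ body c, P[f]? = some body ∧ Eval P [u] body v c ∧ c + 1 ≤ (S + 1) ^ N := by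
  intro N
  induction N with
  | zero => intro f u v h; cases h
  | succ N ih =>
    intro f u v h
    simp only [callFn] at h
    split at h
    next body hf =>
      obtain ⟨c, hc, hle⟩ :=
        exists_eval_of_eval_eq_some (Nat.one_le_pow _ _ (Nat.succ_pos S)) ih body _ _ h
      refine ⟨body, c, hf, hc, ?_⟩
      have h1 : size body ≤ S := hS body (List.mem_of_getElem? hf)
      have h2 : 1 ≤ (S + 1) ^ N := Nat.one_le_pow _ _ (Nat.succ_pos S)
      calc c + 1 ≤ S * (S + 1) ^ N + (S + 1) ^ N :=
            add_le_add (hle.trans (Nat.mul_le_mul_right _ h1)) h2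
        _ = (S + 1) ^ (N + 1) := by ring
    · cases h

theorem outputsWithin_of_callFn {P : Program} {S : ℕ} (hS : ∀ body ∈ P, size body ≤ S)
    {N : ℕ} {u v : Val} (h : callFn P N 0 u = some v) :
    P.OutputsWithin u v (((S : ℝ) + 2) ^ (N + 1)) := by
  obtain ⟨body, c, hf, hc, hle⟩ := exists_eval_of_callFn_eq_some hS N 0 u v h
  refine ⟨1 + c + 1, .call (.var (by simp)) hf hc, ?_⟩
  have h1 : 1 ≤ (S + 1) ^ N := Nat.one_le_pow _ _ (Nat.succ_pos S)
  have h2 : 1 + c + 1 ≤ (S + 2) ^ (N + 1) :=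
    calc 1 + c + 1 ≤ (S + 1) ^ N + (S + 1) ^ N := by omega
      _ ≤ (S + 2) ^ N * (S + 2) := by
        have h3 : (S + 1) ^ N ≤ (S + 2) ^ N := Nat.pow_le_pow_left (Nat.le_succ (S + 1)) N
        nlinarith [Nat.zero_le (S * (S + 2) ^ N)]
      _ = (S + 2) ^ (N + 1) := by ring
  exact_mod_cast h2

/-! ### The program -/

/-- `arg` is the argument of the function that is being called. -/
abbrev arg : Expr := .var 0

/-! The indices of the functions of the program; the main function has index `0`. -/

abbrev fnAdd : ℕ := 1
abbrev fnScale : ℕ := 2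
abbrev fnMul : ℕ := 3
abbrev fnMap : ℕ := 4
abbrev fnMapMap : ℕ := 5
abbrev fnRows : ℕ := 6
abbrev fnComb : ℕ := 7
abbrev fnState : ℕ := 8
abbrev fnStateRows : ℕ := 9
abbrev fnStateRow : ℕ := 10
abbrev fnTrace : ℕ := 11
abbrev fnDiag : ℕ := 12
abbrev fnTails : ℕ := 13
abbrev fnLift : ℕ := 14
abbrev fnApply : ℕ := 15
abbrev fnConst : ℕ := 16
abbrev fnHorner : ℕ := 17
abbrev fnTraceJet : ℕ := 18
abbrev fnMulJet : ℕ := 19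
abbrev fnDivJet : ℕ := 20
abbrev fnTop : ℕ := 21

/-- Argument `(u, v)`: the entrywise sum of two trees of the same shape. -/
def bodyAdd : Expr :=
  .ifCons (.head arg)
    (.cons (.call fnAdd (.cons (.head (.head arg)) (.head (.tail arg))))
      (.call fnAdd (.cons (.tail (.head arg)) (.tail (.tail arg)))))
    (.add (.head arg) (.tail arg))

/-- Argument `(c, u)`: the number `c` times the tree `u`. -/
def bodyScale : Expr :=
  .ifCons (.tail arg)
    (.cons (.call fnScale (.cons (.head arg) (.head (.tail arg))))
      (.call fnScale (.cons (.head arg) (.tail (.tail arg)))))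
    (.mul (.head arg) (.tail arg))

/-- The argument `(a, (b, (u, v)))` with other last components. -/
def withLast (u v : Expr) : Expr :=
  .cons (.head arg) (.cons (.head (.tail arg)) (.cons u v))

/-- The third component of the argument. -/
def arg₃ : Expr := .head (.tail (.tail arg))

/-- The fourth component of the argument. -/
def arg₄ : Expr := .tail (.tail (.tail arg))

/-- Argument `(xs, zs, h, T)`: the operator `h` on the spins `xs` times the operator `T` on the
spins `zs`. -/
def bodyMul : Expr :=
  .ifCons (.head arg)
    (.ifEq (.head (.head arg)) (.head (.head (.head (.tail arg))))
      (.call fnRows (.cons (.tail (.head arg)) (.cons (.tail (.head (.tail arg)))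
        (.cons arg₃ arg₄))))
      (.call fnMapMap (.cons (.head arg) (.cons (.tail (.head (.tail arg)))
        (.cons arg₃ arg₄)))))
    (.call fnScale (.cons arg₃ arg₄))

/-- Argument `(xs, zs, h, L)`: multiplies all members of the list `L` by `h`. -/
def bodyMap : Expr :=
  .ifCons arg₄
    (.cons (.call fnMul (withLast arg₃ (.head arg₄))) (.call fnMap (withLast arg₃ (.tail arg₄))))
    .zero

/-- Argument `(xs, zs, h, L)`: multiplies all entries of the list of lists `L` by `h`. -/
def bodyMapMap : Expr :=
  .ifCons arg₄
    (.cons (.call fnMap (withLast arg₃ (.head arg₄)))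
      (.call fnMapMap (withLast arg₃ (.tail arg₄))))
    .zero

/-- Argument `(xs, zs, H, T)`: the product of the matrix of operators `H` with the matrix of
operators `T`. -/
def bodyRows : Expr :=
  .ifCons arg₃
    (.cons (.call fnComb (withLast (.head arg₃) arg₄)) (.call fnRows (withLast (.tail arg₃) arg₄)))
    .zero

/-- Argument `(xs, zs, r, T)`: the product of the nonempty row of operators `r` with the matrix of
operators `T`. -/
def bodyComb : Expr :=
  .ifCons (.tail arg₃)
    (.call fnAdd (.cons (.call fnMap (withLast (.head arg₃) (.head arg₄)))
      (.call fnComb (withLast (.tail arg₃) (.tail arg₄)))))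
    (.call fnMap (withLast (.head arg₃) (.head arg₄)))

/-- Argument `zs`: the product state on the spins `zs`. -/
def bodyState : Expr :=
  .ifCons arg (.call fnStateRows (.cons (.call fnState (.tail arg)) (.tail (.head arg)))) .one

/-- Argument `(R, A)`: the matrix of the multiples of `R` by the entries of the matrix `A`. -/
def bodyStateRows : Expr :=
  .ifCons (.tail arg)
    (.cons (.call fnStateRow (.cons (.head arg) (.head (.tail arg))))
      (.call fnStateRows (.cons (.head arg) (.tail (.tail arg)))))
    .zero

/-- Argument `(R, r)`: the list of the multiples of `R` by the entries of the list `r`. -/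
def bodyStateRow : Expr :=
  .ifCons (.tail arg)
    (.cons (.call fnScale (.cons (.head (.tail arg)) (.head arg)))
      (.call fnStateRow (.cons (.head arg) (.tail (.tail arg)))))
    .zero

/-- Argument `(zs, T)`: the trace of the operator `T` on the spins `zs`. -/
def bodyTrace : Expr :=
  .ifCons (.head arg) (.call fnDiag (.cons (.tail (.head arg)) (.tail arg))) (.tail arg)

/-- Argument `(zs, L)`: the sum of the traces of the diagonal entries of the matrix `L` of operators
on the spins `zs`. -/
def bodyDiag : Expr :=
  .ifCons (.tail arg)
    (.add (.call fnTrace (.cons (.head arg) (.head (.head (.tail arg)))))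
      (.call fnDiag (.cons (.head arg) (.call fnTails (.tail (.tail arg))))))
    .zero

/-- Argument `L`: removes the first entry from each member of the list of lists `L`. -/
def bodyTails : Expr :=
  .ifCons arg (.cons (.tail (.head arg)) (.call fnTails (.tail arg))) .zero

/-- Argument `(h, zs, hs, T)`: the product of the term `h` with the jet `T`, where `hs` is the list
of the variables of the jet. -/
def bodyLift : Expr :=
  .ifCons arg₃
    (.cons (.call fnLift (withLast (.tail arg₃) (.head arg₄)))
      (.call fnLift (withLast (.tail arg₃) (.tail arg₄))))
    (.call fnMul (.cons (.head (.head arg)) (.cons (.head (.tail arg))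
      (.cons (.tail (.head arg)) arg₄))))

/-- Argument `(zs, hs, T)`: the product of the Hamiltonian with the jet `T`, where `hs` is the list
of the terms that belong to the variables of the jet. -/
def bodyApply : Expr :=
  .ifCons (.head (.tail arg))
    (.cons
      (.call fnApply (.cons (.head arg) (.cons (.tail (.head (.tail arg)))
        (.head (.tail (.tail arg))))))
      (.call fnAdd (.cons
        (.call fnLift (.cons (.head (.head (.tail arg))) (.cons (.head arg)
          (.cons (.tail (.head (.tail arg))) (.head (.tail (.tail arg)))))))
        (.call fnApply (.cons (.head arg) (.cons (.tail (.head (.tail arg)))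
          (.tail (.tail (.tail arg)))))))))
    (.call fnScale (.cons .zero (.tail (.tail arg))))

/-- Argument `(hs, T)`: the jet of the constant function `T`. -/
def bodyConst : Expr :=
  .ifCons (.head arg)
    (.cons (.call fnConst (.cons (.tail (.head arg)) (.tail arg)))
      (.call fnConst (.cons (.tail (.head arg)) (.call fnScale (.cons .zero (.tail arg))))))
    (.tail arg)

/-- Argument `(r, c, s, zs, hs, R)`: Horner's scheme for the truncated exponential series of `s`
times the Hamiltonian, applied to the jet `R`. The length of the list `r` is the remaining order,
and `c` is the next denominator. -/
def bodyHorner : Expr :=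
  .ifCons (.head arg)
    (.bind (.tail (.tail (.tail arg)))
      (.call fnAdd (.cons (.tail (.tail arg))
        (.call fnScale (.cons
          (.div (.head (.tail (.tail (.var 1)))) (.head (.tail (.var 1))))
          (.call fnApply (.cons (.head arg) (.cons (.head (.tail arg))
            (.call fnHorner (.cons (.tail (.head (.var 1)))
              (.cons (.add (.head (.tail (.var 1))) .one)
                (.tail (.tail (.var 1))))))))))))))
    (.tail (.tail (.tail (.tail (.tail arg)))))

/-- Argument `(zs, hs, T)`: the jet of the trace, where `hs` is the list of the variables. -/
def bodyTraceJet : Expr :=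
  .ifCons (.head (.tail arg))
    (.cons
      (.call fnTraceJet (.cons (.head arg) (.cons (.tail (.head (.tail arg)))
        (.head (.tail (.tail arg))))))
      (.call fnTraceJet (.cons (.head arg) (.cons (.tail (.head (.tail arg)))
        (.tail (.tail (.tail arg)))))))
    (.call fnTrace (.cons (.head arg) (.tail (.tail arg))))

/-- Argument `(u, v)`: the product of two jets of numbers. -/
def bodyMulJet : Expr :=
  .ifCons (.head arg)
    (.cons (.call fnMulJet (.cons (.head (.head arg)) (.head (.tail arg))))
      (.call fnAdd (.cons
        (.call fnMulJet (.cons (.head (.head arg)) (.tail (.tail arg))))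
        (.call fnMulJet (.cons (.tail (.head arg)) (.head (.tail arg)))))))
    (.mul (.head arg) (.tail arg))

/-- Argument `(u, v)`: the quotient of two jets of numbers, from
`∂(u/v) = (∂u - (u/v) ∂v) / v`. -/
def bodyDivJet : Expr :=
  .ifCons (.head arg)
    (.bind (.call fnDivJet (.cons (.head (.head arg)) (.head (.tail arg))))
      (.cons arg
        (.call fnDivJet (.cons
          (.call fnAdd (.cons (.tail (.head (.var 1)))
            (.call fnScale (.cons (.sub .zero .one)
              (.call fnMulJet (.cons arg (.tail (.tail (.var 1)))))))))
          (.head (.tail (.var 1)))))))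
    (.div (.head arg) (.tail arg))

/-- Argument `u`: the derivative with respect to all the variables of the jet `u`. -/
def bodyTop : Expr := .ifCons arg (.call fnTop (.tail arg)) arg

/-- Argument `[t, zs, hs]`: the cluster derivative. The function `L` with jet `(L₀, L₁)` has
`∂ log L = L₁ / L₀` for the derivative with respect to the first variable. -/
def bodyMain : Expr :=
  .bind (.head (.tail arg))
    (.bind (.head (.tail (.tail (.var 1))))
      (.bind
        (.call fnTraceJet (.cons (.var 1) (.cons (.var 0)
          (.call fnHorner (.cons (.var 0) (.cons .one
            (.cons (.sub .zero (.mul .imag (.head (.var 2))))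
              (.cons (.var 1) (.cons (.var 0)
                (.call fnConst (.cons (.var 0) (.call fnState (.var 1)))))))))))))
        (.call fnTop (.call fnDivJet (.cons (.tail arg) (.head arg))))))

/-- The program that computes cluster derivatives. -/
def prog : Program :=
  [bodyMain, bodyAdd, bodyScale, bodyMul, bodyMap, bodyMapMap, bodyRows, bodyComb, bodyState,
    bodyStateRows, bodyStateRow, bodyTrace, bodyDiag, bodyTails, bodyLift, bodyApply, bodyConst,
    bodyHorner, bodyTraceJet, bodyMulJet, bodyDivJet, bodyTop]

theorem size_le_of_mem_prog : ∀ body ∈ prog, size body ≤ 100 := by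
  simp [prog, size, bodyMain, bodyAdd, bodyScale, bodyMul, bodyMap, bodyMapMap, bodyRows, bodyComb,
    bodyState, bodyStateRows, bodyStateRow, bodyTrace, bodyDiag, bodyTails, bodyLift, bodyApply,
    bodyConst, bodyHorner, bodyTraceJet, bodyMulJet, bodyDivJet, bodyTop, withLast, arg₃, arg₄]

/-- Function `f` of the program maps `u` to `v`, with calls nested at most `K` deep. -/
def Computes (K f : ℕ) (u v : Val) : Prop := ∀ N, K ≤ N → callFn prog N f u = some v

theorem Computes.mono {K K' f : ℕ} {u v : Val} (h : Computes K f u v) (hK : K ≤ K') :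
    Computes K' f u v := fun N hN => h N (hK.trans hN)

theorem Computes.of_body {K f : ℕ} {u v : Val} {body : Expr} (hf : prog[f]? = some body)
    (h : ∀ N, K ≤ N → eval (callFn prog N) [u] body = some v) : Computes (K + 1) f u v := by
  intro N hN
  obtain ⟨N, rfl⟩ := Nat.exists_eq_add_one_of_ne_zero (show N ≠ 0 by omega)
  simp only [callFn, hf]
  exact h N (by omega)

/-! ### Linear encodings -/

/-- `w` is the entrywise sum of `u` and `v`. -/
inductive IsSum : Val → Val → Val → Prop
  | num (x y : ℂ) : IsSum (.num x) (.num y) (.num (x + y))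
  | cons {a b a' b' a'' b'' : Val} : IsSum a a' a'' → IsSum b b' b'' →
      IsSum (.cons a b) (.cons a' b') (.cons a'' b'')

/-- `v` is `c` times `u`. -/
inductive IsScale (c : ℂ) : Val → Val → Prop
  | num (x : ℂ) : IsScale c (.num x) (.num (c * x))
  | cons {a b a' b' : Val} : IsScale c a a' → IsScale c b b' → IsScale c (.cons a b) (.cons a' b')

/-- The height of a tree. -/
def height : Val → ℕ
  | .nil | .num _ => 0
  | .cons u v => max (height u) (height v) + 1

theorem computes_add {u v w : Val} (h : IsSum u v w) :
    Computes (height u + 1) fnAdd (.cons u v) w := by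
  induction h with
  | num x y => exact .of_body rfl fun N hN => by simp [bodyAdd, eval]
  | @cons a b a' b' a'' b'' _ _ iha ihb =>
    refine .of_body rfl fun N hN => ?_
    simp only [height] at hN
    simp [bodyAdd, eval, iha N (by omega), ihb N (by omega)]

theorem computes_scale {c : ℂ} {u v : Val} (h : IsScale c u v) :
    Computes (height u + 1) fnScale (.cons (.num c) u) v := by
  induction h with
  | num x => exact .of_body rfl fun N hN => by simp [bodyScale, eval]
  | @cons a b a' b' _ _ iha ihb =>
    refine .of_body rfl fun N hN => ?_
    simp only [height] at hN
    simp [bodyScale, eval, iha N (by omega), ihb N (by omega)]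

/-- An encoding of the elements of a vector space as trees of height at most `h`, which all have the
same shape and have linear functions at the leaves. -/
structure IsLinEnc {E : Type*} [AddCommGroup E] [Module ℂ E] (enc : E → Val) (h : ℕ) : Prop where
  add : ∀ x y, IsSum (enc x) (enc y) (enc (x + y))
  smul : ∀ (c : ℂ) x, IsScale c (enc x) (enc (c • x))
  height_le : ∀ x, height (enc x) ≤ h

/-- A list, with terminator `0` in place of `nil`, so that the arithmetic of trees applies to lists
of trees. -/
def encList (l : List Val) : Val := l.foldr .cons (.num 0)

@[simp] theorem encList_nil : encList [] = .num 0 := rfl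

@[simp] theorem encList_cons (u : Val) (l : List Val) : encList (u :: l) = .cons u (encList l) :=
  rfl

section IsLinEnc

variable {E F : Type*} [AddCommGroup E] [Module ℂ E] [AddCommGroup F] [Module ℂ F]
  {enc : E → Val} {h : ℕ}

theorem isLinEnc_num : IsLinEnc Val.num 0 where
  add := .num
  smul := fun _ => .num
  height_le _ := le_rfl

theorem IsLinEnc.comp (henc : IsLinEnc enc h) (f : F →ₗ[ℂ] E) :
    IsLinEnc (fun x => enc (f x)) h where
  add x y := by rw [map_add]; exact henc.add _ _
  smul c x := by rw [map_smul]; exact henc.smul _ _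
  height_le x := henc.height_le _

theorem IsLinEnc.list (henc : IsLinEnc enc h) (d : ℕ) :
    IsLinEnc (fun x : Fin d → E => encList (List.ofFn fun i => enc (x i))) (d + h) where
  add x y := by
    induction d with
    | zero => simpa using IsSum.num 0 0
    | succ d ih =>
      simp only [List.ofFn_succ, encList_cons]
      exact .cons (henc.add _ _) (ih (fun i => x i.succ) fun i => y i.succ)
  smul c x := by
    induction d with
    | zero => simpa using IsScale.num (c := c) 0
    | succ d ih =>
      simp only [List.ofFn_succ, encList_cons]
      exact .cons (henc.smul _ _) (ih fun i => x i.succ)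
  height_le x := by
    induction d with
    | zero => simp [height]
    | succ d ih =>
      simp only [List.ofFn_succ, encList_cons, height]
      have h1 := henc.height_le (x 0)
      have h2 := ih fun i => x i.succ
      omega

theorem IsLinEnc.computes_add (henc : IsLinEnc enc h) (x y : E) :
    Computes (h + 1) fnAdd (.cons (enc x) (enc y)) (enc (x + y)) :=
  (ClusterAlgorithm.computes_add (henc.add x y)).mono (by simpa using henc.height_le x)

theorem IsLinEnc.computes_smul (henc : IsLinEnc enc h) (c : ℂ) (x : E) :
    Computes (h + 1) fnScale (.cons (.num c) (enc x)) (enc (c • x)) :=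
  (ClusterAlgorithm.computes_scale (henc.smul c x)).mono (by simpa using henc.height_le x)

end IsLinEnc

/-! ### Operators on the spins of a cluster -/

/-- Four arguments of a function. -/
def args (a b u v : Val) : Val := .cons a (.cons b (.cons u v))

@[simp] theorem ofList_nil : Val.ofList [] = .nil := rfl

@[simp] theorem ofList_cons (u : Val) (l : List Val) :
    Val.ofList (u :: l) = .cons u (Val.ofList l) := rfl

theorem computes_map {K : ℕ} {xs zs h : Val} {p : ℕ} {u w : Fin p → Val}
    (H : ∀ i, Computes K fnMul (args xs zs h (u i)) (w i)) :
    Computes (K + p + 1) fnMap (args xs zs h (encList (List.ofFn u)))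
      (encList (List.ofFn w)) := by
  induction p with
  | zero => exact .of_body rfl fun N hN => by simp [bodyMap, eval, args, arg₄]
  | succ p ih =>
    refine .of_body rfl fun N hN => ?_
    have h1 := H 0 N (by omega)
    have h2 := ih (fun i => H i.succ) N (by omega)
    simp only [args] at h1 h2
    simp [bodyMap, eval, args, arg₃, arg₄, withLast, List.ofFn_succ, h1, h2]

theorem computes_mapMap {K : ℕ} {xs zs h : Val} {p : ℕ} {u w : Fin p → Val}
    (H : ∀ i, Computes K fnMap (args xs zs h (u i)) (w i)) :
    Computes (K + p + 1) fnMapMap (args xs zs h (encList (List.ofFn u)))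
      (encList (List.ofFn w)) := by
  induction p with
  | zero => exact .of_body rfl fun N hN => by simp [bodyMapMap, eval, args, arg₄]
  | succ p ih =>
    refine .of_body rfl fun N hN => ?_
    have h1 := H 0 N (by omega)
    have h2 := ih (fun i => H i.succ) N (by omega)
    simp only [args] at h1 h2
    simp [bodyMapMap, eval, args, arg₃, arg₄, withLast, List.ofFn_succ, h1, h2]

theorem computes_rows {K : ℕ} {xs zs T : Val} {p : ℕ} {r w : Fin p → Val}
    (H : ∀ i, Computes K fnComb (args xs zs (r i) T) (w i)) :
    Computes (K + p + 1) fnRows (args xs zs (Val.ofList (List.ofFn r)) T)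
      (encList (List.ofFn w)) := by
  induction p with
  | zero => exact .of_body rfl fun N hN => by simp [bodyRows, eval, args, arg₃]
  | succ p ih =>
    refine .of_body rfl fun N hN => ?_
    have h1 := H 0 N (by omega)
    have h2 := ih (fun i => H i.succ) N (by omega)
    simp only [args] at h1 h2
    simp [bodyRows, eval, args, arg₃, arg₄, withLast, List.ofFn_succ, h1, h2]

theorem computes_comb {E : Type*} [AddCommGroup E] [Module ℂ E] {enc : E → Val} {h : ℕ}
    (henc : IsLinEnc enc h) {K : ℕ} (hK : h + 1 ≤ K) {xs zs : Val} {p : ℕ}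
    (hp : p ≠ 0) {g T : Fin p → Val} {Q : Fin p → E}
    (H : ∀ k, Computes K fnMap (args xs zs (g k) (T k)) (enc (Q k))) :
    Computes (K + p) fnComb (args xs zs (Val.ofList (List.ofFn g)) (encList (List.ofFn T)))
      (enc (∑ k, Q k)) := by
  obtain ⟨p, rfl⟩ := Nat.exists_eq_succ_of_ne_zero hp
  clear hp
  change Computes (K + p + 1) _ _ _
  induction p with
  | zero =>
    refine .of_body rfl fun N hN => ?_
    have h1 := H 0 N (by omega)
    simp only [args] at h1
    simp [bodyComb, eval, args, arg₃, arg₄, withLast, List.ofFn_succ, h1]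
  | succ p ih =>
    refine .of_body rfl fun N hN => ?_
    have h1 := H 0 N (by omega)
    have h2 := ih (fun i => H i.succ) N (by omega)
    have h3 := henc.computes_add (Q 0) (∑ k : Fin (p + 1), Q k.succ) N (by omega)
    rw [← Fin.sum_univ_succ] at h3
    simp only [args, List.ofFn_succ, ofList_cons, encList_cons] at h1 h2
    simp only [Fin.succ_zero_eq_one] at h2
    simp [bodyComb, eval, args, arg₃, arg₄, withLast, List.ofFn_succ, h1, h2, h3]

variable {n d : ℕ}

/-- The matrix elements of an operator between states with spin `z` in state `i` on the left and in
state `j` on the right, divided by `d`. The division makes up for the states of the spin `z` when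
the trace of the result is taken over the states of all spins. -/
noncomputable def slice (z : Fin n) (i j : Fin d) : SpinOp n d →ₗ[ℂ] SpinOp n d where
  toFun M := Matrix.of fun a b => (d : ℂ)⁻¹ * M (Function.update a z i) (Function.update b z j)
  map_add' M N := by ext a b; exact mul_add _ _ _
  map_smul' c M := by ext a b; exact mul_left_comm _ _ _

theorem slice_apply (z : Fin n) (i j : Fin d) (M : SpinOp n d) (a b : Fin n → Fin d) :
    slice z i j M a b = (d : ℂ)⁻¹ * M (Function.update a z i) (Function.update b z j) := rfl

/-- The partial trace of an operator onto the spins in a list without repetitions, as a nested array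
with the order of indices of `encodeOp`. -/
noncomputable def encT : List (Fin n) → SpinOp n d → Val
  | [], M => .num M.trace
  | z :: zs, M => encList (List.ofFn fun i => encList (List.ofFn fun j => encT zs (slice z i j M)))

theorem isLinEnc_encT : ∀ zs : List (Fin n),
    IsLinEnc (encT zs : SpinOp n d → Val) (zs.length * (2 * d))
  | [] => by
    rw [List.length_nil, zero_mul]
    exact isLinEnc_num.comp (Matrix.traceLinearMap (Fin n → Fin d) ℂ ℂ)
  | z :: zs => by
    have h := ((((isLinEnc_encT zs).list d).list d).comp
      (LinearMap.pi fun i => LinearMap.pi fun j => slice (d := d) z i j))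
    have e : d + (d + zs.length * (2 * d)) = (z :: zs).length * (2 * d) := by
      simp only [List.length_cons]; ring
    rw [e] at h
    exact h

/-- The product of the operator with matrix `A` on the spins `e 0, e 1, …` with `M`, computed spin
by spin. -/
noncomputable def contract : (r : ℕ) → (Fin r → Fin n) →
    ((Fin r → Fin d) → (Fin r → Fin d) → ℂ) → SpinOp n d → SpinOp n d
  | 0, _, A, M => A Fin.elim0 Fin.elim0 • M
  | r + 1, e, A, M => Matrix.of fun a b => ∑ k, contract r (fun s => e s.succ)
      (fun p q => A (Fin.cons (a (e 0)) p) (Fin.cons k q))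
      (Matrix.of fun a' b' => M (Function.update a' (e 0) k) b') a b

theorem contract_succ_apply {r : ℕ} (e : Fin (r + 1) → Fin n)
    (A : (Fin (r + 1) → Fin d) → (Fin (r + 1) → Fin d) → ℂ) (M : SpinOp n d)
    (a b : Fin n → Fin d) :
    contract (r + 1) e A M a b = ∑ k, contract r (fun s => e s.succ)
      (fun p q => A (Fin.cons (a (e 0)) p) (Fin.cons k q))
      (Matrix.of fun a' b' => M (Function.update a' (e 0) k) b') a b := rfl

theorem slice_contract_of_ne (z : Fin n) (i j : Fin d) : ∀ (r : ℕ) (e : Fin r → Fin n)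
    (A : (Fin r → Fin d) → (Fin r → Fin d) → ℂ) (M : SpinOp n d), (∀ s, e s ≠ z) →
    slice z i j (contract r e A M) = contract r e A (slice z i j M)
  | 0, _, _, _, _ => map_smul _ _ _
  | r + 1, e, A, M, he => by
    ext a b
    rw [slice_apply, contract_succ_apply, contract_succ_apply, Finset.mul_sum]
    refine Finset.sum_congr rfl fun k _ => ?_
    rw [← slice_apply, slice_contract_of_ne z i j r _ _ _ fun s => he s.succ,
      Function.update_of_ne (he 0)]
    congr 1
    ext a' b'
    simp only [slice_apply, Matrix.of_apply]
    rw [Function.update_comm (he 0)]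

theorem slice_contract_zero {r : ℕ} {e : Fin (r + 1) → Fin n} (he : Function.Injective e)
    (A : (Fin (r + 1) → Fin d) → (Fin (r + 1) → Fin d) → ℂ) (M : SpinOp n d) (i j : Fin d) :
    slice (e 0) i j (contract (r + 1) e A M) =
      ∑ k, contract r (fun s => e s.succ) (fun p q => A (Fin.cons i p) (Fin.cons k q))
        (slice (e 0) k j M) := by
  have hne : ∀ s : Fin r, e s.succ ≠ e 0 := fun s h => Fin.succ_ne_zero s (he h)
  ext a b
  rw [slice_apply, contract_succ_apply, Finset.mul_sum, Matrix.sum_apply]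
  refine Finset.sum_congr rfl fun k _ => ?_
  rw [← slice_apply, slice_contract_of_ne _ i j r _ _ _ hne, Function.update_self]
  congr 1
  ext a' b'
  simp [slice_apply, Matrix.of_apply]

theorem contract_apply : ∀ (r : ℕ) (e : Fin r → Fin n), Function.Injective e →
    ∀ (A : (Fin r → Fin d) → (Fin r → Fin d) → ℂ) (M : SpinOp n d) (a b : Fin n → Fin d),
    contract r e A M a b =
      ∑ c : Fin n → Fin d, if ∀ v, v ∉ Set.range e → a v = c v then
        A (fun s => a (e s)) (fun s => c (e s)) * M c b else 0
  | 0, e, _, A, M, a, b => by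
    have h : ∀ c : Fin n → Fin d, (∀ v, v ∉ Set.range e → a v = c v) ↔ c = a := fun c =>
      ⟨fun h => funext fun v => (h v (by rintro ⟨s, _⟩; exact s.elim0)).symm, fun h => by simp [h]⟩
    simp only [h, Finset.sum_ite_eq', Finset.mem_univ, if_true, contract, Matrix.smul_apply,
      smul_eq_mul]
    congr 2 <;> exact Subsingleton.elim _ _
  | r + 1, e, he, A, M, a, b => by
    have he' : Function.Injective fun s : Fin r => e s.succ := he.comp (Fin.succ_injective r)
    have hne : ∀ s : Fin r, e s.succ ≠ e 0 := fun s h => Fin.succ_ne_zero s (he h)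
    rw [contract_succ_apply]
    simp_rw [contract_apply r _ he', ← Finset.sum_filter]
    rw [Finset.sum_sigma']
    refine Finset.sum_bij' (fun x _ => Function.update x.2 (e 0) x.1)
      (fun c _ => ⟨c (e 0), Function.update c (e 0) (a (e 0))⟩) ?_ ?_ ?_ ?_ ?_
    · rintro ⟨k, c⟩ hc
      simp only [Finset.mem_sigma, Finset.mem_filter, Finset.mem_univ, true_and] at hc ⊢
      intro v hv
      have hv0 : v ≠ e 0 := fun h => hv ⟨0, h.symm⟩
      rw [Function.update_of_ne hv0]
      exact hc v fun ⟨s, h⟩ => hv ⟨s.succ, h⟩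
    · intro c hc
      simp only [Finset.mem_sigma, Finset.mem_filter, Finset.mem_univ, true_and] at hc ⊢
      intro v hv
      by_cases hv0 : v = e 0
      · rw [hv0, Function.update_self]
      · rw [Function.update_of_ne hv0]
        refine hc v fun ⟨s, h⟩ => ?_
        rcases Fin.eq_zero_or_eq_succ s with rfl | ⟨s, rfl⟩
        · exact hv0 h.symm
        · exact hv ⟨s, h⟩
    · rintro ⟨k, c⟩ hc
      simp only [Finset.mem_sigma, Finset.mem_filter, Finset.mem_univ, true_and] at hc
      have h0 : a (e 0) = c (e 0) := hc _ fun ⟨s, h⟩ => hne s h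
      simp [h0]
    · intro c hc
      simp
    · rintro ⟨k, c⟩ hc
      have h1 : ∀ s : Fin r, Function.update c (e 0) k (e s.succ) = c (e s.succ) := fun s =>
        Function.update_of_ne (hne s) _ _
      simp only [Matrix.of_apply]
      congr 2
      · funext s
        rcases Fin.eq_zero_or_eq_succ s with rfl | ⟨s, rfl⟩ <;> simp
      · funext s
        rcases Fin.eq_zero_or_eq_succ s with rfl | ⟨s, rfl⟩ <;> simp [h1]

theorem embedOp_mul (X : Finset (Fin n))
    (A : Matrix (Fin X.card → Fin d) (Fin X.card → Fin d) ℂ) (M : SpinOp n d) :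
    embedOp X A * M = contract X.card (X.orderEmbOfFin rfl) A M := by
  ext a b
  refine Eq.trans ?_ (contract_apply _ _ (X.orderEmbOfFin rfl).injective A M a b).symm
  rw [Matrix.mul_apply]
  refine Finset.sum_congr rfl fun c _ => ?_
  simp only [embedOp, Finset.range_orderEmbOfFin, Finset.mem_coe, ite_mul, zero_mul]

/-- A list of spins with their density matrices, as in the input. -/
noncomputable def encSites (ρ : Fin n → Matrix (Fin d) (Fin d) ℂ) (zs : List (Fin n)) : Val :=
  Val.ofList (zs.map fun v => .cons (encodeSpin v) (encodeMatrix (ρ v)))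

/-- A list of spins, as in the input. -/
def encSpins (xs : List (Fin n)) : Val := Val.ofList (xs.map encodeSpin)

/-- A factor on the spin `z` is contracted if the operator acts on `z`; otherwise all slices at `z`
are multiplied by the operator. The order of the spins `e` has to agree with that of `zs`. -/
theorem computes_mul (hd : Fin n → d ≠ 0) (ρ : Fin n → Matrix (Fin d) (Fin d) ℂ) :
    ∀ (zs : List (Fin n)), zs.Nodup → ∀ (r : ℕ) (e : Fin r → Fin n), Function.Injective e →
    (List.ofFn e).Sublist zs → ∀ (A : (Fin r → Fin d) → (Fin r → Fin d) → ℂ) (M : SpinOp n d),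
    Computes (zs.length * (3 * d + 3) + 2) fnMul
      (args (encSpins (List.ofFn e)) (encSites ρ zs) (encodeOp r A) (encT zs M))
      (encT zs (contract r e A M))
  | zs, _, 0, e, _, _, A, M => by
    have h := (isLinEnc_encT zs).computes_smul (A Fin.elim0 Fin.elim0) M
    have hK : zs.length * (2 * d) + 1 ≤ zs.length * (3 * d + 3) + 1 := by gcongr; omega
    refine .of_body rfl fun N hN => ?_
    simp [bodyMul, eval, args, arg₃, arg₄, encSpins, encodeOp, contract, h N (hK.trans hN)]
  | [], _, r + 1, e, _, hs, _, _ => by simp [List.ofFn_succ] at hs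
  | z :: zs, hz, r + 1, e, he, hs, A, M => by
    obtain ⟨hz1, hz2⟩ := List.nodup_cons.1 hz
    have e1 : (z :: zs).length * (3 * d + 3) + 2 =
        (zs.length * (3 * d + 3) + 2 + d + 1 + d + d + 1) + 1 := by
      simp only [List.length_cons]; ring
    rw [e1]
    rw [List.ofFn_succ] at hs
    by_cases hez : e 0 = z
    · -- the factor of the spin `z` is contracted
      subst hez
      have he' : Function.Injective fun s : Fin r => e s.succ := he.comp (Fin.succ_injective r)
      have hs' := (List.cons_sublist_cons.1 hs)
      have h1 := fun i k j => computes_mul hd ρ zs hz2 r _ he' hs'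
        (fun p q => A (Fin.cons i p) (Fin.cons k q)) (slice (e 0) k j M)
      have h2 := fun i k => computes_map (h1 i k)
      have h3 := fun i => computes_comb (Q := fun k j => contract r (fun s => e s.succ)
        (fun p q => A (Fin.cons i p) (Fin.cons k q)) (slice (e 0) k j M))
        ((isLinEnc_encT zs).list d) (by
          have : zs.length * (2 * d) ≤ zs.length * (3 * d + 3) := by gcongr; omega
          show _ ≤ zs.length * (3 * d + 3) + 2 + d + 1
          omega) (hd (e 0)) (h2 i)
      have h4 := computes_rows h3
      refine .of_body rfl fun N hN => ?_
      have h5 := h4 N (by omega)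
      simp only [args, Finset.sum_apply, encSites, encSpins, List.map_ofFn] at h5
      simp only [encT, slice_contract_zero he, encodeOp, encSites, encSpins]
      have h6 : encodeSpin (e 0) = .num ((e 0 : ℕ) : ℂ) := rfl
      simp [bodyMul, eval, args, arg₃, arg₄, h6, h5]
    · -- the operator acts trivially on the spin `z`
      have hs' : (List.ofFn e).Sublist zs := by
        rw [List.ofFn_succ]
        rcases List.sublist_cons_iff.1 hs with h | ⟨_, h, _⟩
        · exact h
        · exact absurd (List.cons.inj h).1 hez
      have hne : ∀ s, e s ≠ z := fun s h =>
        hz1 (h ▸ hs'.subset (List.mem_ofFn.2 ⟨s, rfl⟩))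
      have h1 := fun i j => computes_mul hd ρ zs hz2 (r + 1) e he hs' A (slice z i j M)
      have h2 := fun i => computes_map (h1 i)
      have h3 := computes_mapMap h2
      refine .of_body rfl fun N hN => ?_
      have h4 := h3 N (by omega)
      have hnum : ((e 0 : ℕ) : ℂ) ≠ ((z : ℕ) : ℂ) := fun h => hez (Fin.ext (Nat.cast_injective h))
      simp only [args, encSites, encSpins] at h4
      simp only [encT, slice_contract_of_ne z _ _ _ e A M hne, encSites, encSpins]
      simp [bodyMul, eval, args, arg₃, arg₄, encodeSpin, hnum]
      simpa [List.ofFn_succ (f := e), encodeSpin] using h4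

theorem computes_tails {p : ℕ} {u w : Fin p → Val} :
    Computes (p + 1) fnTails (encList (List.ofFn fun i => .cons (u i) (w i)))
      (encList (List.ofFn w)) := by
  induction p with
  | zero => exact .of_body rfl fun N hN => by simp [bodyTails, eval]
  | succ p ih =>
    refine .of_body rfl fun N hN => ?_
    simp [bodyTails, eval, List.ofFn_succ,
      ih (u := fun i => u i.succ) (w := fun i => w i.succ) N (by omega)]

theorem computes_diag {K : ℕ} {zs : Val} {p : ℕ} {B : Fin p → Fin p → Val} {x : Fin p → ℂ}
    (H : ∀ i, Computes K fnTrace (.cons zs (B i i)) (.num (x i))) :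
    Computes (K + p + 1) fnDiag
      (.cons zs (encList (List.ofFn fun i => encList (List.ofFn fun j => B i j))))
      (.num (∑ i, x i)) := by
  induction p with
  | zero => exact .of_body rfl fun N hN => by simp [bodyDiag, eval]
  | succ p ih =>
    refine .of_body rfl fun N hN => ?_
    have h1 := H 0 N (by omega)
    have h2 := ih (B := fun i j => B i.succ j.succ) (fun i => H i.succ) N (by omega)
    have h3 := computes_tails (u := fun i : Fin p => B i.succ 0)
      (w := fun i => encList (List.ofFn fun j : Fin p => B i.succ j.succ)) N (by omega)
    simp [bodyDiag, eval, List.ofFn_succ, h1, h2, h3, Fin.sum_univ_succ]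

/-- The normalization of `slice` makes the sum over the diagonal slices preserve the trace. -/
theorem sum_trace_slice (hd : d ≠ 0) (z : Fin n) (M : SpinOp n d) :
    ∑ i, (slice z i i M).trace = M.trace := by
  have hd' : (d : ℂ) ≠ 0 := Nat.cast_ne_zero.2 hd
  simp only [Matrix.trace, Matrix.diag_apply, slice_apply, ← Finset.mul_sum]
  rw [inv_mul_eq_iff_eq_mul₀ hd']
  let g : Fin d × (Fin n → Fin d) → Fin d × (Fin n → Fin d) :=
    fun x => (x.2 z, Function.update x.2 z x.1)
  have hg : Function.Involutive g := fun x => by simp [g]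
  calc ∑ i, ∑ c : Fin n → Fin d, M (Function.update c z i) (Function.update c z i)
      = ∑ x : Fin d × (Fin n → Fin d), M (g x).2 (g x).2 :=
        (Fintype.sum_prod_type fun x => M (g x).2 (g x).2).symm
    _ = ∑ x : Fin d × (Fin n → Fin d), M x.2 x.2 :=
        Fintype.sum_equiv (hg.toPerm g) _ _ fun _ => rfl
    _ = d * ∑ c, M c c := by
        rw [Fintype.sum_prod_type]
        simp

theorem computes_trace (hd : Fin n → d ≠ 0) (ρ : Fin n → Matrix (Fin d) (Fin d) ℂ) :
    ∀ (zs : List (Fin n)) (M : SpinOp n d),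
      Computes (zs.length * (d + 2) + 1) fnTrace (.cons (encSites ρ zs) (encT zs M)) (.num M.trace)
  | [], M => .of_body rfl fun N hN => by simp [bodyTrace, eval, encSites, encT]
  | z :: zs, M => by
    have h1 := computes_diag (B := fun i j => encT zs (slice z i j M)) fun i =>
      computes_trace hd ρ zs (slice z i i M)
    rw [sum_trace_slice (hd z)] at h1
    have e1 : (z :: zs).length * (d + 2) + 1 = (zs.length * (d + 2) + 1 + d + 1) + 1 := by
      simp only [List.length_cons]; ring
    rw [e1]
    refine .of_body rfl fun N hN => ?_
    have h2 := h1 N (by omega)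
    simp only [encSites] at h2
    simp [bodyTrace, eval, encSites, encT, h2]

theorem computes_stateRow {K : ℕ} {R : Val} {p : ℕ} {x : Fin p → ℂ} {w : Fin p → Val}
    (H : ∀ i, Computes K fnScale (.cons (.num (x i)) R) (w i)) :
    Computes (K + p + 1) fnStateRow (.cons R (Val.ofList (List.ofFn fun i => .num (x i))))
      (encList (List.ofFn w)) := by
  induction p with
  | zero => exact .of_body rfl fun N hN => by simp [bodyStateRow, eval]
  | succ p ih =>
    refine .of_body rfl fun N hN => ?_
    have h1 := H 0 N (by omega)
    have h2 := ih (fun i => H i.succ) N (by omega)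
    simp [bodyStateRow, eval, List.ofFn_succ, h1, h2]

theorem computes_stateRows {K : ℕ} {R : Val} {p : ℕ} {r w : Fin p → Val}
    (H : ∀ i, Computes K fnStateRow (.cons R (r i)) (w i)) :
    Computes (K + p + 1) fnStateRows (.cons R (Val.ofList (List.ofFn r)))
      (encList (List.ofFn w)) := by
  induction p with
  | zero => exact .of_body rfl fun N hN => by simp [bodyStateRows, eval]
  | succ p ih =>
    refine .of_body rfl fun N hN => ?_
    have h1 := H 0 N (by omega)
    have h2 := ih (fun i => H i.succ) N (by omega)
    simp [bodyStateRows, eval, List.ofFn_succ, h1, h2]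

/-- The tensor product of operators on the single spins. -/
noncomputable def prodOp (ρ : Fin n → Matrix (Fin d) (Fin d) ℂ) : SpinOp n d :=
  Matrix.of fun a b => ∏ v, ρ v (a v) (b v)

theorem trace_prodOp (ρ : Fin n → Matrix (Fin d) (Fin d) ℂ) :
    (prodOp ρ).trace = ∏ v, (ρ v).trace := by
  simp only [prodOp, Matrix.trace, Matrix.diag_apply, Matrix.of_apply]
  rw [Finset.prod_univ_sum, Fintype.piFinset_univ]

/-- A slice of a product operator is a multiple of the product operator in which the factor at the
slice is replaced by a constant matrix with trace `1`. -/
theorem slice_prodOp (z : Fin n) (i j : Fin d) (ρ : Fin n → Matrix (Fin d) (Fin d) ℂ) :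
    slice z i j (prodOp ρ) =
      ρ z i j • prodOp (Function.update ρ z (Matrix.of fun _ _ => (d : ℂ)⁻¹)) := by
  ext a b
  simp only [slice_apply, prodOp, Matrix.smul_apply, Matrix.of_apply, smul_eq_mul]
  rw [← Finset.mul_prod_erase _ _ (Finset.mem_univ z),
    ← Finset.mul_prod_erase (a := z) Finset.univ
      (fun v => Function.update ρ z (Matrix.of fun _ _ => (d : ℂ)⁻¹) v (a v) (b v))
      (Finset.mem_univ z)]
  have h : ∀ v ∈ Finset.univ.erase z,
      ρ v (Function.update a z i v) (Function.update b z j v) =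
        Function.update ρ z (Matrix.of fun _ _ => (d : ℂ)⁻¹) v (a v) (b v) := fun v hv => by
    have hv' := Finset.ne_of_mem_erase hv
    simp [hv']
  rw [Finset.prod_congr rfl h]
  simp only [Function.update_self, Matrix.of_apply]
  ring

/-- Only the factors `ρ v` at the spins `zs` are known to the program. The other factors of the
product state enter through their traces only, so the induction is over all states that agree with `ρ` on
`zs`. -/
theorem computes_state (hd : Fin n → d ≠ 0) (ρ : Fin n → Matrix (Fin d) (Fin d) ℂ) :
    ∀ (zs : List (Fin n)), zs.Nodup → ∀ σ : Fin n → Matrix (Fin d) (Fin d) ℂ,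
      (∀ v, (σ v).trace = 1) → (∀ v ∈ zs, σ v = ρ v) →
      Computes (zs.length * (2 * d + 4) + 1) fnState (encSites ρ zs) (encT zs (prodOp σ))
  | [], _, σ, hσ, _ => .of_body rfl fun N hN => by
    simp [bodyState, eval, encSites, encT, trace_prodOp, hσ]
  | z :: zs, hz, σ, hσ, hρ => by
    obtain ⟨hz1, hz2⟩ := List.nodup_cons.1 hz
    have hd' : (d : ℂ) ≠ 0 := Nat.cast_ne_zero.2 (hd z)
    set σ' := Function.update σ z (Matrix.of fun _ _ => (d : ℂ)⁻¹) with hσ'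
    have h1 := computes_state hd ρ zs hz2 σ'
      (fun v => by
        by_cases hv : v = z
        · subst hv
          simp [hσ', Matrix.trace, hd']
        · simp [hσ', hv, hσ v])
      (fun v hv => by
        have hvz : v ≠ z := fun h => hz1 (h ▸ hv)
        simp [hσ', hvz, hρ v (List.mem_cons_of_mem _ hv)])
    have h2 := fun i j => (isLinEnc_encT zs).computes_smul (σ z i j) (prodOp σ')
    have h3 := computes_stateRows fun i => computes_stateRow (h2 i)
    have e1 : (z :: zs).length * (2 * d + 4) + 1 =
        (zs.length * (2 * d + 4) + 1 + 2 * d + 3) + 1 := by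
      simp only [List.length_cons]; ring
    have e2 : zs.length * (2 * d) ≤ zs.length * (2 * d + 4) := by gcongr; omega
    rw [e1]
    refine .of_body rfl fun N hN => ?_
    have h4 := h1 N (by omega)
    have h5 := h3 N (by omega)
    rw [hρ z List.mem_cons_self] at h5
    simp only [encSites] at h4 h5
    simp only [encT, slice_prodOp, ← hσ', hρ z List.mem_cons_self, encSites]
    have h6 : encodeMatrix (ρ z) =
      Val.ofList (List.ofFn fun i => Val.ofList (List.ofFn fun j => .num (ρ z i j))) := rfl
    simp [bodyState, eval, h4, h5, h6]

/-! ### Jets of analytic functions -/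

open scoped Topology

section Jets

set_option linter.unusedSectionVars false

variable {ι : Type*} [Fintype ι] [DecidableEq ι]
  {E F : Type*} [NormedAddCommGroup E] [NormedSpace ℂ E] [NormedAddCommGroup F] [NormedSpace ℂ F]

/-- The partial derivative `∂f/∂x_i` of a vector-valued function. -/
noncomputable def dir (i : ι) (f : (ι → ℝ) → E) : (ι → ℝ) → E :=
  fun x => fderiv ℝ f x (Pi.single i 1)

theorem dir_congr {f g : (ι → ℝ) → E} {x : ι → ℝ} (h : f =ᶠ[𝓝 x] g) (i : ι) :
    dir i f =ᶠ[𝓝 x] dir i g :=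
  (h.fderiv (𝕜 := ℝ)).mono fun y hy => by simp only [dir, hy]

theorem analyticAt_dir [CompleteSpace E] {f : (ι → ℝ) → E} {x : ι → ℝ} (hf : AnalyticAt ℝ f x)
    (i : ι) :
    AnalyticAt ℝ (dir i f) x :=
  ((ContinuousLinearMap.apply ℝ E (Pi.single i (1 : ℝ) : ι → ℝ)).analyticAt _).comp hf.fderiv

theorem eventually_differentiableAt {f : (ι → ℝ) → E} {x : ι → ℝ} (hf : AnalyticAt ℝ f x)
    [CompleteSpace E] : ∀ᶠ y in 𝓝 x, DifferentiableAt ℝ f y :=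
  hf.eventually_analyticAt.mono fun _ hy => hy.differentiableAt

variable [CompleteSpace E] [CompleteSpace F]

theorem dir_add {f g : (ι → ℝ) → E} {x : ι → ℝ} (hf : AnalyticAt ℝ f x) (hg : AnalyticAt ℝ g x)
    (i : ι) : dir i (f + g) =ᶠ[𝓝 x] dir i f + dir i g := by
  filter_upwards [eventually_differentiableAt hf, eventually_differentiableAt hg] with y h1 h2
  simp [dir, fderiv_add h1 h2]

theorem dir_sub {f g : (ι → ℝ) → E} {x : ι → ℝ} (hf : AnalyticAt ℝ f x) (hg : AnalyticAt ℝ g x)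
    (i : ι) : dir i (f - g) =ᶠ[𝓝 x] dir i f - dir i g := by
  filter_upwards [eventually_differentiableAt hf, eventually_differentiableAt hg] with y h1 h2
  simp [dir, fderiv_sub h1 h2]

theorem dir_clm (T : E →L[ℝ] F) {f : (ι → ℝ) → E} {x : ι → ℝ} (hf : AnalyticAt ℝ f x) (i : ι) :
    dir i (fun y => T (f y)) =ᶠ[𝓝 x] fun y => T (dir i f y) := by
  filter_upwards [eventually_differentiableAt hf] with y h1
  have h := (T.hasFDerivAt.comp y h1.hasFDerivAt).fderiv
  simp only [dir]
  exact congrArg (fun S : (ι → ℝ) →L[ℝ] F => S (Pi.single i 1)) h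

theorem dir_const (c : E) (i : ι) : dir i (fun _ => c) = fun _ => (0 : E) := by
  funext x
  simp [dir]

/-- The partial derivatives at the origin of order at most one in each of the listed variables, as a
binary tree, with the encoded values at its leaves. -/
noncomputable def jet (enc : E → Val) : List ι → ((ι → ℝ) → E) → Val
  | [], f => enc (f 0)
  | i :: l, f => .cons (jet enc l f) (jet enc l (dir i f))

theorem jet_congr (enc : E → Val) (l : List ι) {f g : (ι → ℝ) → E} (h : f =ᶠ[𝓝 0] g) :
    jet enc l f = jet enc l g := by
  induction l generalizing f g with
  | nil => simp only [jet, h.eq_of_nhds]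
  | cons i l ih => simp only [jet, ih h, ih (dir_congr h i)]

theorem jet_clm (enc : F → Val) (T : E →L[ℝ] F) (l : List ι) {f : (ι → ℝ) → E}
    (hf : AnalyticAt ℝ f 0) : jet enc l (fun y => T (f y)) = jet (fun u => enc (T u)) l f := by
  induction l generalizing f with
  | nil => rfl
  | cons i l ih =>
    simp only [jet, ih hf, jet_congr enc l (dir_clm T hf i), ih (analyticAt_dir hf i)]

section LinEnc

variable {enc : E → Val} {h : ℕ}

theorem IsLinEnc.isSum_jet (henc : IsLinEnc enc h) (l : List ι) {f g : (ι → ℝ) → E}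
    (hf : AnalyticAt ℝ f 0) (hg : AnalyticAt ℝ g 0) :
    IsSum (jet enc l f) (jet enc l g) (jet enc l (f + g)) := by
  induction l generalizing f g with
  | nil => exact henc.add _ _
  | cons i l ih =>
    simp only [jet, jet_congr enc l (dir_add hf hg i)]
    exact .cons (ih hf hg) (ih (analyticAt_dir hf i) (analyticAt_dir hg i))

theorem dir_smul (c : ℂ) {f : (ι → ℝ) → E} {x : ι → ℝ} (hf : AnalyticAt ℝ f x) (i : ι) :
    dir i (c • f) =ᶠ[𝓝 x] c • dir i f := by
  filter_upwards [eventually_differentiableAt hf] with y h1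
  simp [dir, fderiv_const_smul h1]

theorem IsLinEnc.isScale_jet (henc : IsLinEnc enc h) (c : ℂ) (l : List ι) {f : (ι → ℝ) → E}
    (hf : AnalyticAt ℝ f 0) : IsScale c (jet enc l f) (jet enc l (c • f)) := by
  induction l generalizing f with
  | nil => exact henc.smul _ _
  | cons i l ih =>
    simp only [jet, jet_congr enc l (dir_smul c hf i)]
    exact .cons (ih hf) (ih (analyticAt_dir hf i))

theorem IsLinEnc.height_jet_le (henc : IsLinEnc enc h) (l : List ι) (f : (ι → ℝ) → E) :
    height (jet enc l f) ≤ l.length + h := by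
  induction l generalizing f with
  | nil => simpa [jet] using henc.height_le _
  | cons i l ih =>
    have h1 := ih f
    have h2 := ih (dir i f)
    simp only [jet, height, List.length_cons]
    omega

theorem IsLinEnc.computes_add_jet (henc : IsLinEnc enc h) (l : List ι) {f g : (ι → ℝ) → E}
    (hf : AnalyticAt ℝ f 0) (hg : AnalyticAt ℝ g 0) :
    Computes (l.length + h + 1) fnAdd (.cons (jet enc l f) (jet enc l g)) (jet enc l (f + g)) :=
  (ClusterAlgorithm.computes_add (henc.isSum_jet l hf hg)).mono
    (by simpa using henc.height_jet_le l f)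

theorem IsLinEnc.computes_smul_jet (henc : IsLinEnc enc h) (c : ℂ) (l : List ι)
    {f : (ι → ℝ) → E} (hf : AnalyticAt ℝ f 0) :
    Computes (l.length + h + 1) fnScale (.cons (.num c) (jet enc l f)) (jet enc l (c • f)) :=
  (ClusterAlgorithm.computes_scale (henc.isScale_jet c l hf)).mono
    (by simpa using henc.height_jet_le l f)

theorem IsLinEnc.computes_const (henc : IsLinEnc enc h) (g : ι → Val) (l : List ι) (c : E) :
    Computes (l.length + h + 1) fnConst (.cons (Val.ofList (l.map g)) (enc c))
      (jet enc l fun _ => c) := by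
  induction l generalizing c with
  | nil => exact .of_body rfl fun N hN => by simp [bodyConst, eval, jet]
  | cons i l ih =>
    rw [List.length_cons, Nat.add_right_comm l.length 1 h]
    refine .of_body rfl fun N hN => ?_
    have h1 := ih c N (by omega)
    have h2 := henc.computes_smul 0 c N (by omega)
    have h3 := ih 0 N (by omega)
    rw [zero_smul] at h2
    simp [bodyConst, eval, jet, dir_const, h1, h2, h3]

end LinEnc

theorem dir_mul {f g : (ι → ℝ) → ℂ} {x : ι → ℝ} (hf : AnalyticAt ℝ f x) (hg : AnalyticAt ℝ g x)
    (i : ι) : dir i (f * g) =ᶠ[𝓝 x] f * dir i g + dir i f * g := by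
  filter_upwards [eventually_differentiableAt hf, eventually_differentiableAt hg] with y h1 h2
  simp [dir, fderiv_mul h1 h2, mul_comm]

theorem dir_div {f g : (ι → ℝ) → ℂ} {x : ι → ℝ} (hf : AnalyticAt ℝ f x) (hg : AnalyticAt ℝ g x)
    (hx : g x ≠ 0) (i : ι) :
    dir i (f / g) =ᶠ[𝓝 x] (dir i f + (-1 : ℂ) • (f / g * dir i g)) / g := by
  -- differentiate `f = (f / g) * g`
  have h0 : ∀ᶠ y in 𝓝 x, g y ≠ 0 := hg.continuousAt.eventually_ne hx
  have h1 : f =ᶠ[𝓝 x] f / g * g := h0.mono fun y hy => by simp [hy]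
  filter_upwards [dir_congr h1 i, dir_mul (hf.div hg hx) hg i, h0] with y h2 h3 h4
  have h5 := h2.trans h3
  simp only [Pi.add_apply, Pi.mul_apply, Pi.div_apply, Pi.smul_apply, smul_eq_mul] at h5 ⊢
  rw [eq_div_iff h4, h5]
  ring

theorem computes_mulJet (l : List ι) {f g : (ι → ℝ) → ℂ} (hf : AnalyticAt ℝ f 0)
    (hg : AnalyticAt ℝ g 0) :
    Computes (l.length + 1) fnMulJet (.cons (jet .num l f) (jet .num l g))
      (jet .num l (f * g)) := by
  induction l generalizing f g with
  | nil => exact .of_body rfl fun N hN => by simp [bodyMulJet, eval, jet]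
  | cons i l ih =>
    refine .of_body rfl fun N hN => ?_
    rw [List.length_cons] at hN
    have hf' := analyticAt_dir hf i
    have hg' := analyticAt_dir hg i
    have h1 := ih hf hg N hN
    have h2 := ih hf hg' N hN
    have h3 := ih hf' hg N hN
    have h4 := isLinEnc_num.computes_add_jet l (hf.mul hg') (hf'.mul hg) N hN
    rw [← jet_congr .num l (dir_mul hf hg i)] at h4
    simp [bodyMulJet, eval, jet, h1, h2, h3, h4]

theorem computes_divJet (l : List ι) {f g : (ι → ℝ) → ℂ} (hf : AnalyticAt ℝ f 0)
    (hg : AnalyticAt ℝ g 0) (h0 : g 0 ≠ 0) :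
    Computes (l.length + 1) fnDivJet (.cons (jet .num l f) (jet .num l g))
      (jet .num l (f / g)) := by
  induction l generalizing f with
  | nil => exact .of_body rfl fun N hN => by simp [bodyDivJet, eval, jet, h0]
  | cons i l ih =>
    refine .of_body rfl fun N hN => ?_
    rw [List.length_cons] at hN
    have hf' := analyticAt_dir hf i
    have hg' := analyticAt_dir hg i
    have hm := (hf.div hg h0).mul hg'
    have hm' : AnalyticAt ℝ ((-1 : ℂ) • (f / g * dir i g)) 0 := hm.const_smul
    have h1 := ih hf N hN
    have h2 := computes_mulJet l (hf.div hg h0) hg' N hN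
    have h3 := isLinEnc_num.computes_smul_jet (-1) l hm N hN
    have h4 := isLinEnc_num.computes_add_jet l hf' hm' N hN
    have h5 := ih (hf'.add hm') N hN
    rw [← jet_congr .num l (dir_div hf hg h0 i)] at h5
    generalize (-1 : ℂ) • (f / g * dir i g) = q at h3 h4 h5
    simp [bodyDivJet, eval, jet, h1, h2, h3, h4, h5]

/-- The top coefficient of a jet: all the partial derivatives, the first variable first. -/
theorem computes_top (l : List ι) (f : (ι → ℝ) → ℂ) :
    Computes (l.length + 1) fnTop (jet .num l f)
      (.num (l.foldl (fun g i => dir i g) f 0)) := by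
  induction l generalizing f with
  | nil => exact .of_body rfl fun N hN => by simp [bodyTop, eval, jet]
  | cons i l ih =>
    refine .of_body rfl fun N hN => ?_
    simp [bodyTop, eval, jet, ih (dir i f) N hN]

/-! ### Iterated partial derivatives -/

theorem partialDeriv_eventuallyEq_dir {f : (ι → ℝ) → ℂ} {x : ι → ℝ} (hf : AnalyticAt ℝ f x)
    (i : ι) : partialDeriv i f =ᶠ[𝓝 x] dir i f := by
  filter_upwards [eventually_differentiableAt hf] with y h1
  have h2 : HasFDerivAt f (fderiv ℝ f y) (Function.update y i (y i)) := by
    rw [Function.update_eq_self]; exact h1.hasFDerivAt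
  exact (h2.comp_hasDerivAt _ (hasDerivAt_update y i (y i))).deriv

theorem dir_comm {f : (ι → ℝ) → E} {x : ι → ℝ} (hf : AnalyticAt ℝ f x) (i j : ι) :
    dir i (dir j f) =ᶠ[𝓝 x] dir j (dir i f) := by
  filter_upwards [hf.eventually_analyticAt] with y h1
  have h2 : DifferentiableAt ℝ (fderiv ℝ f) y := h1.fderiv.differentiableAt
  have h3 : ∀ i j : ι, dir i (dir j f) y =
      fderiv ℝ (fderiv ℝ f) y (Pi.single i 1) (Pi.single j 1) := fun i j => by
    have := ((ContinuousLinearMap.apply ℝ E (Pi.single j (1 : ℝ) : ι → ℝ)).hasFDerivAt.comp y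
      h2.hasFDerivAt).fderiv
    exact congrArg (fun S : (ι → ℝ) →L[ℝ] E => S (Pi.single i 1)) this
  rw [h3, h3]
  exact (h1.contDiffAt (n := ⊤)).isSymmSndFDerivAt (by simp) _ _

theorem analyticAt_foldr_dir {f : (ι → ℝ) → E} {x : ι → ℝ} (hf : AnalyticAt ℝ f x) (l : List ι) :
    AnalyticAt ℝ (l.foldr dir f) x := by
  induction l with
  | nil => exact hf
  | cons i l ih => exact analyticAt_dir ih i

theorem foldr_dir_perm {f : (ι → ℝ) → E} {x : ι → ℝ} (hf : AnalyticAt ℝ f x) {l l' : List ι}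
    (h : l.Perm l') : l.foldr dir f =ᶠ[𝓝 x] l'.foldr dir f := by
  induction h with
  | nil => rfl
  | cons i _ ih => exact dir_congr ih i
  | swap i j l => exact dir_comm (analyticAt_foldr_dir hf l) _ _
  | trans _ _ ih1 ih2 => exact ih1.trans ih2

theorem foldr_partialDeriv_eventuallyEq {f : (ι → ℝ) → ℂ} {x : ι → ℝ} (hf : AnalyticAt ℝ f x)
    (l : List ι) : l.foldr partialDeriv f =ᶠ[𝓝 x] l.foldr dir f := by
  induction l with
  | nil => rfl
  | cons i l ih =>
    refine Filter.EventuallyEq.trans ?_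
      (partialDeriv_eventuallyEq_dir (analyticAt_foldr_dir hf l) i)
    -- partial derivatives near `x` depend on the values near `x` only
    filter_upwards [ih.eventuallyEq_nhds] with y hy
    have ht : Filter.Tendsto (fun s : ℝ => Function.update y i s) (𝓝 (y i)) (𝓝 y) := by
      have := (continuous_const.update i continuous_id : Continuous
        fun s : ℝ => Function.update y i s).tendsto (y i)
      simpa using this
    exact Filter.EventuallyEq.deriv_eq (ht.eventually hy)

/-- The cluster derivative is a list of partial derivatives, in any order. -/
theorem clusterDeriv_eq {f : (ι → ℝ) → ℂ} (hf : AnalyticAt ℝ f 0) (l : List ι) :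
    clusterDeriv (l : Multiset ι) f = l.foldl (fun g i => dir i g) f 0 := by
  have h : ((l : Multiset ι).toList).Perm l.reverse :=
    (Multiset.coe_eq_coe.1 (Multiset.coe_toList _)).trans (List.reverse_perm l).symm
  rw [clusterDeriv, (foldr_partialDeriv_eventuallyEq hf _).eq_of_nhds,
    (foldr_dir_perm hf h).eq_of_nhds, List.foldr_reverse]

theorem dir_log {f : (ι → ℝ) → ℂ} {x : ι → ℝ} (hf : AnalyticAt ℝ f x) (hx : f x ∈ Complex.slitPlane)
    (i : ι) : dir i (fun y => Complex.log (f y)) =ᶠ[𝓝 x] dir i f / f := by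
  filter_upwards [eventually_differentiableAt hf,
    hf.continuousAt.eventually_mem (Complex.isOpen_slitPlane.mem_nhds hx)] with y h1 h2
  have h : fderiv ℝ (fun y => Complex.log (f y)) y = _ :=
    (((Complex.hasStrictDerivAt_log h2).hasDerivAt.hasFDerivAt.restrictScalars ℝ).comp y
      h1.hasFDerivAt).fderiv
  simp [dir, h, div_eq_mul_inv]

/-! ### Vanishing to higher order -/

/-- The function `f` is analytic at the origin, and its partial derivatives of order less than `k`
vanish there. -/
def VanishesToOrder : ℕ → ((ι → ℝ) → E) → Prop
  | 0, f => AnalyticAt ℝ f 0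
  | k + 1, f => AnalyticAt ℝ f 0 ∧ f 0 = 0 ∧ ∀ i, VanishesToOrder k (dir i f)

theorem VanishesToOrder.congr {k : ℕ} {f g : (ι → ℝ) → E} (h : VanishesToOrder k f)
    (hfg : f =ᶠ[𝓝 0] g) : VanishesToOrder k g := by
  induction k generalizing f g with
  | zero => exact AnalyticAt.congr h hfg
  | succ k ih =>
    exact ⟨h.1.congr hfg, hfg.eq_of_nhds ▸ h.2.1, fun i => ih (h.2.2 i) (dir_congr hfg i)⟩

theorem VanishesToOrder.of_succ {k : ℕ} {f : (ι → ℝ) → E} (h : VanishesToOrder (k + 1) f) :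
    VanishesToOrder k f := by
  induction k generalizing f with
  | zero => exact h.1
  | succ k ih => exact ⟨h.1, h.2.1, fun i => ih (h.2.2 i)⟩

theorem VanishesToOrder.add {k : ℕ} {f g : (ι → ℝ) → E} (hf : VanishesToOrder k f)
    (hg : VanishesToOrder k g) : VanishesToOrder k (f + g) := by
  induction k generalizing f g with
  | zero => exact AnalyticAt.add hf hg
  | succ k ih =>
    exact ⟨hf.1.add hg.1, by simp [hf.2.1, hg.2.1], fun i =>
      (ih (hf.2.2 i) (hg.2.2 i)).congr (dir_add hf.1 hg.1 i).symm⟩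

theorem VanishesToOrder.clm {k : ℕ} {f : (ι → ℝ) → E} (hf : VanishesToOrder k f) (T : E →L[ℝ] F) :
    VanishesToOrder k fun y => T (f y) := by
  induction k generalizing f with
  | zero => exact (T.analyticAt _).comp hf
  | succ k ih =>
    exact ⟨(T.analyticAt _).comp hf.1, by simp [hf.2.1], fun i =>
      (ih (hf.2.2 i)).congr (dir_clm T hf.1 i).symm⟩

theorem jet_eq_of_vanishesToOrder (enc : E → Val) (l : List ι) {f g : (ι → ℝ) → E}
    (hf : AnalyticAt ℝ f 0) (hg : AnalyticAt ℝ g 0) (h : VanishesToOrder (l.length + 1) (f - g)) :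
    jet enc l f = jet enc l g := by
  induction l generalizing f g with
  | nil =>
    have := h.2.1
    simp only [Pi.sub_apply, sub_eq_zero] at this
    simp only [jet, this]
  | cons i l ih =>
    simp only [jet, ih hf hg h.of_succ, ih (analyticAt_dir hf i) (analyticAt_dir hg i)
      ((h.2.2 i).congr (dir_sub hf hg i))]

end Jets

section Algebra

set_option linter.unusedSectionVars false

variable {ι : Type*} [Fintype ι] [DecidableEq ι]
  {A : Type*} [NormedRing A] [NormedAlgebra ℂ A] [CompleteSpace A]

theorem analyticAt_clm_mul (B : (ι → ℝ) →L[ℝ] A) {f : (ι → ℝ) → A} {x : ι → ℝ}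
    (hf : AnalyticAt ℝ f x) : AnalyticAt ℝ (fun y => B y * f y) x :=
  (B.analyticAt x).mul hf

theorem dir_clm_mul (B : (ι → ℝ) →L[ℝ] A) {f : (ι → ℝ) → A} {x : ι → ℝ}
    (hf : AnalyticAt ℝ f x) (i : ι) :
    dir i (fun y => B y * f y) =ᶠ[𝓝 x]
      (fun y => B (Pi.single i 1) * f y) + fun y => B y * dir i f y := by
  filter_upwards [eventually_differentiableAt hf] with y h1
  have h : fderiv ℝ (fun y => B y * f y) y = _ :=
    ((B.hasFDerivAt (x := y)).mul' h1.hasFDerivAt).fderiv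
  simp [dir, h, add_comm]

theorem VanishesToOrder.clm_mul (B : (ι → ℝ) →L[ℝ] A) {k : ℕ} {f : (ι → ℝ) → A}
    (hf : VanishesToOrder k f) : VanishesToOrder (k + 1) fun y => B y * f y := by
  induction k generalizing f with
  | zero =>
    exact ⟨analyticAt_clm_mul B hf, by simp, fun i => analyticAt_dir (analyticAt_clm_mul B hf) i⟩
  | succ k ih =>
    refine ⟨analyticAt_clm_mul B hf.1, by simp, fun i => ?_⟩
    have h1 := hf.clm (ContinuousLinearMap.mul ℝ A (B (Pi.single i 1)))
    exact (h1.add (ih (hf.2.2 i))).congr (dir_clm_mul B hf.1 i).symm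

/-! ### Remainders of the exponential series -/

/-- The function `∑ r, c! / (c + r)! x ^ r`. It is the exponential function for `c = 0`. -/
noncomputable def expTail (c : ℕ) (x : A) : A :=
  FormalMultilinearSeries.ofScalarsSum (E := A) (fun r => (c.factorial : ℂ) / (c + r).factorial) x

theorem radius_expTail (c : ℕ) : (FormalMultilinearSeries.ofScalars A
    (fun r => (c.factorial : ℂ) / (c + r).factorial)).radius = ⊤ := by
  apply FormalMultilinearSeries.ofScalars_radius_eq_top_of_tendsto
  · refine Filter.Eventually.of_forall fun r => ?_
    exact div_ne_zero (Nat.cast_ne_zero.2 (Nat.factorial_ne_zero _))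
      (Nat.cast_ne_zero.2 (Nat.factorial_ne_zero _))
  · have h : ∀ r : ℕ, ‖(c.factorial : ℂ) / (c + (r + 1)).factorial‖ /
        ‖(c.factorial : ℂ) / (c + r).factorial‖ = 1 / ((r + c : ℕ) + 1 : ℝ) := fun r => by
      have h1 : (c.factorial : ℝ) ≠ 0 := Nat.cast_ne_zero.2 (Nat.factorial_ne_zero _)
      have h2 : ((c + r).factorial : ℝ) ≠ 0 := Nat.cast_ne_zero.2 (Nat.factorial_ne_zero _)
      rw [← add_assoc, Nat.factorial_succ]
      simp only [norm_div, Complex.norm_natCast]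
      push_cast
      field_simp
      ring
    simp only [Nat.succ_eq_add_one, h]
    exact (tendsto_one_div_add_atTop_nhds_zero_nat (𝕜 := ℝ)).comp (Filter.tendsto_add_atTop_nat c)

theorem analyticAt_expTail (c : ℕ) (x : A) : AnalyticAt ℂ (expTail c) x := by
  have h := (FormalMultilinearSeries.ofScalars A
    (fun r => (c.factorial : ℂ) / (c + r).factorial)).hasFPowerSeriesOnBall
      (by rw [radius_expTail]; exact ENNReal.zero_lt_top)
  rw [radius_expTail] at h
  exact h.analyticAt_of_mem (by simp)

theorem hasSum_expTail (c : ℕ) (x : A) :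
    HasSum (fun r => ((c.factorial : ℂ) / (c + r).factorial) • x ^ r) (expTail c x) := by
  have h := (FormalMultilinearSeries.ofScalars A
    (fun r => (c.factorial : ℂ) / (c + r).factorial)).hasSum (x := x)
      (by rw [radius_expTail]; simp)
  simp only [FormalMultilinearSeries.ofScalars_apply_eq] at h
  exact h

theorem expTail_zero (x : A) : expTail 0 x = NormedSpace.exp x := by
  rw [NormedSpace.exp_eq_tsum ℂ]
  simpa using (hasSum_expTail 0 x).tsum_eq.symm

theorem expTail_succ (c : ℕ) (x : A) :
    expTail c x = 1 + ((c : ℂ) + 1)⁻¹ • (x * expTail (c + 1) x) := by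
  have h1 := ((hasSum_expTail (c + 1) x).mul_left x).const_smul ((c : ℂ) + 1)⁻¹
  have h2 := (hasSum_nat_add_iff' 1).2 (hasSum_expTail c x)
  have h3 : expTail c x - 1 = ((c : ℂ) + 1)⁻¹ • (x * expTail (c + 1) x) := by
    have hc : (c.factorial : ℂ) ≠ 0 := Nat.cast_ne_zero.2 (Nat.factorial_ne_zero _)
    have hc1 : (c : ℂ) + 1 ≠ 0 := Nat.cast_add_one_ne_zero c
    simp only [Finset.sum_range_one, add_zero, div_self hc, pow_zero, one_smul] at h2
    refine h2.unique (h1.congr_fun fun r => ?_)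
    rw [mul_smul_comm, smul_smul, ← pow_succ', Nat.add_right_comm, add_assoc, Nat.factorial_succ c]
    congr 1
    push_cast
    field_simp
  rw [← h3, add_sub_cancel]

end Algebra

/-! ### Jets of the exponential of a linear combination -/

section Echo

set_option linter.unusedSectionVars false

open scoped Topology

variable {ι : Type*} [Fintype ι] [DecidableEq ι]
  {A : Type*} [NormedRing A] [NormedAlgebra ℂ A] [CompleteSpace A]

/-- The linear combination `∑ X, lam X • h X` as a function of the coefficients. -/
noncomputable def linComb (h : ι → A) : (ι → ℝ) →L[ℝ] A :=
  ∑ X, (ContinuousLinearMap.proj X : (ι → ℝ) →L[ℝ] ℝ).smulRight (h X)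

theorem linComb_apply (h : ι → A) (lam : ι → ℝ) : linComb h lam = ∑ X, lam X • h X := by
  simp [linComb]

theorem linComb_single (h : ι → A) (X : ι) : linComb h (Pi.single X 1) = h X := by
  rw [linComb_apply, Finset.sum_eq_single X]
  · simp
  · intro Y _ hY
    simp [hY]
  · simp

/-- The product with `h X` is computed by the function `fnMul`, for all the listed `X`. -/
def MulSpec (K : ℕ) (enc : A → Val) (zs : Val) (xs op : ι → Val) (h : ι → A) (l : List ι) : Prop :=
  ∀ X ∈ l, ∀ M : A, Computes K fnMul (args (xs X) zs (op X) (enc M)) (enc (h X * M))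

variable {enc : A → Val} {b K : ℕ} {zs : Val} {xs op : ι → Val} {h : ι → A}

theorem computes_lift {X : ι} (hX : MulSpec K enc zs xs op h [X]) (g : ι → Val) (l : List ι)
    (f : (ι → ℝ) → A) :
    Computes (l.length + K + 1) fnLift
      (args (.cons (xs X) (op X)) zs (Val.ofList (l.map g)) (jet enc l f))
      (jet (fun M => enc (h X * M)) l f) := by
  induction l generalizing f with
  | nil =>
    refine .of_body rfl fun N hN => ?_
    have h1 := hX X List.mem_cons_self (f 0) N (by simpa using hN)
    simp only [args] at h1
    simp [bodyLift, eval, args, arg₃, arg₄, jet, h1]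
  | cons Y l ih =>
    rw [List.length_cons]
    refine .of_body rfl fun N hN => ?_
    have h1 := ih f N (by omega)
    have h2 := ih (dir Y f) N (by omega)
    simp only [args] at h1 h2
    simp [bodyLift, eval, args, arg₃, arg₄, withLast, jet, h1, h2]

/-- The product rule `∂(H f) = h f + H ∂f` turns multiplication by the Hamiltonian `H`, which
vanishes at the origin, into a recursion on jets. -/
theorem computes_apply (henc : IsLinEnc enc b) (hK : b + 1 ≤ K) (l : List ι)
    (hl : MulSpec K enc zs xs op h l) {f : (ι → ℝ) → A} (hf : AnalyticAt ℝ f 0) :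
    Computes (l.length + K + 2) fnApply
      (.cons zs (.cons (Val.ofList (l.map fun X => .cons (xs X) (op X))) (jet enc l f)))
      (jet enc l fun lam => linComb h lam * f lam) := by
  induction l generalizing f with
  | nil =>
    refine .of_body rfl fun N hN => ?_
    have h1 := henc.computes_smul 0 (f 0) N (by simp at hN; omega)
    rw [zero_smul] at h1
    simp [bodyApply, eval, jet, h1]
  | cons X l ih =>
    have hX : MulSpec K enc zs xs op h [X] := fun Y hY =>
      hl Y (List.mem_singleton.1 hY ▸ List.mem_cons_self)
    have hl' : MulSpec K enc zs xs op h l := fun Y hY => hl Y (List.mem_cons_of_mem _ hY)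
    have hdir := analyticAt_dir hf X
    have hT : AnalyticAt ℝ (fun lam => h X * f lam) 0 := analyticAt_const.mul hf
    rw [List.length_cons]
    refine .of_body rfl fun N hN => ?_
    have h1 := ih hl' hf N (by omega)
    have h2 := computes_lift hX (fun X => .cons (xs X) (op X)) l f N (by omega)
    have h3 := ih hl' hdir N (by omega)
    have h4 := henc.computes_add_jet l hT (analyticAt_clm_mul (linComb h) hdir) N (by omega)
    have h5 := dir_clm_mul (linComb h) hf X
    rw [linComb_single] at h5
    have h6 : jet enc l (fun lam => h X * f lam) = jet (fun M => enc (h X * M)) l f :=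
      jet_clm enc (ContinuousLinearMap.mul ℝ A (h X)) l hf
    rw [← jet_congr enc l h5, h6] at h4
    simp only [args] at h2
    simp [bodyApply, eval, jet, h1, h2, h3, h4]

/-- Horner's scheme for the first `j + 1` terms of the series `expTail c` at the argument
`s • linComb h lam`, multiplied by `R`. -/
noncomputable def hornerSum (h : ι → A) (s : ℂ) (R : A) : ℕ → ℕ → (ι → ℝ) → A
  | 0, _ => fun _ => R
  | j + 1, c => (fun _ => R) +
      (s / ((c : ℂ) + 1)) • fun lam => linComb h lam * hornerSum h s R j (c + 1) lam

theorem analyticAt_hornerSum (s : ℂ) (R : A) (j c : ℕ) : AnalyticAt ℝ (hornerSum h s R j c) 0 := by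
  induction j generalizing c with
  | zero => exact analyticAt_const
  | succ j ih => exact analyticAt_const.add ((analyticAt_clm_mul _ (ih _)).const_smul)

theorem computes_horner (henc : IsLinEnc enc b) (hK : b + 1 ≤ K) (l : List ι)
    (hl : MulSpec K enc zs xs op h l) (s : ℂ) (R : A) (g : ι → Val) (r : List ι) (c : ℕ) :
    Computes (l.length + K + 3 + r.length) fnHorner
      (.cons (Val.ofList (r.map g)) (.cons (.num ((c : ℂ) + 1)) (.cons (.num s)
        (.cons zs (.cons (Val.ofList (l.map fun X => .cons (xs X) (op X)))
          (jet enc l fun _ => R))))))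
      (jet enc l (hornerSum h s R r.length c)) := by
  induction r generalizing c with
  | nil => exact .of_body rfl fun N hN => by simp [bodyHorner, eval, hornerSum]
  | cons X r ih =>
    rw [List.length_cons, ← add_assoc]
    refine .of_body rfl fun N hN => ?_
    have hc : (c : ℂ) + 1 ≠ 0 := Nat.cast_add_one_ne_zero c
    have hq : AnalyticAt ℝ (hornerSum h s R r.length (c + 1)) 0 := analyticAt_hornerSum s R _ _
    have h1 := ih (c + 1) N (by omega)
    have h2 := computes_apply henc hK l hl hq N (by omega)
    have h3 := henc.computes_smul_jet (s / ((c : ℂ) + 1)) l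
      (analyticAt_clm_mul (linComb h) hq) N (by omega)
    have h4 := henc.computes_add_jet l (analyticAt_const (v := R))
      ((analyticAt_clm_mul (linComb h) hq).const_smul (c := s / ((c : ℂ) + 1))) N (by omega)
    rw [Nat.cast_add_one] at h1
    simp [bodyHorner, eval, hc, h1, h2, h3, h4, hornerSum]

theorem analyticAt_expTail_mul (h : ι → A) (s : ℂ) (R : A) (c : ℕ) :
    AnalyticAt ℝ (fun lam => expTail c (s • linComb h lam) * R) 0 := by
  refine AnalyticAt.mul (AnalyticAt.comp (g := expTail c) (f := fun lam => s • linComb h lam)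
    (analyticAt_expTail c _).restrictScalars ?_) analyticAt_const
  exact AnalyticAt.const_smul (c := s) ((linComb h).analyticAt 0)

/-- Horner's scheme agrees with the exponential series to the order that jets can see. -/
theorem vanishesToOrder_sub_hornerSum (s : ℂ) (R : A) (j c : ℕ) :
    VanishesToOrder (j + 1)
      ((fun lam => expTail c (s • linComb h lam) * R) - hornerSum h s R j c) := by
  have key : ∀ (c : ℕ) (q : (ι → ℝ) → A) (k : ℕ),
      VanishesToOrder k ((fun lam => expTail (c + 1) (s • linComb h lam) * R) - q) →
      VanishesToOrder (k + 1) ((fun lam => expTail c (s • linComb h lam) * R) -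
        ((fun _ => R) + (s / ((c : ℂ) + 1)) • fun lam => linComb h lam * q lam)) := by
    intro c q k hq
    have h1 := (hq.clm_mul (linComb h)).clm ((s / ((c : ℂ) + 1)) • ContinuousLinearMap.id ℝ A)
    refine h1.congr (Filter.Eventually.of_forall fun lam => ?_)
    simp only [Pi.sub_apply, Pi.add_apply, Pi.smul_apply, smul_apply,
      ContinuousLinearMap.id_apply]
    rw [expTail_succ c, add_mul, one_mul, add_sub_add_left_eq_sub, mul_sub, smul_sub]
    congr 1
    simp only [smul_mul_assoc, mul_assoc, smul_smul, div_eq_inv_mul]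
  induction j generalizing c with
  | zero =>
    have h1 := key c 0 0 (by
      simpa [VanishesToOrder] using analyticAt_expTail_mul h s R (c + 1))
    refine h1.congr (Filter.Eventually.of_forall fun lam => ?_)
    simp [hornerSum]
  | succ j ih => exact key c _ _ (ih (c + 1))

theorem computes_traceJet {τ : A →L[ℝ] ℂ}
    (hτ : ∀ M, Computes K fnTrace (.cons zs (enc M)) (.num (τ M))) (g : ι → Val)
    (l : List ι) (f : (ι → ℝ) → A) :
    Computes (l.length + K + 1) fnTraceJet (.cons zs (.cons (Val.ofList (l.map g)) (jet enc l f)))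
      (jet (fun M => .num (τ M)) l f) := by
  induction l generalizing f with
  | nil =>
    refine .of_body rfl fun N hN => ?_
    simp [bodyTraceJet, eval, jet, hτ (f 0) N (by simpa using hN)]
  | cons X l ih =>
    rw [List.length_cons]
    refine .of_body rfl fun N hN => ?_
    simp [bodyTraceJet, eval, jet, ih f N (by omega), ih (dir X f) N (by omega)]

/-- The program computes the cluster derivative of the logarithm of `τ (exp (-i t H) R)`, given that
it multiplies by the terms of `H`, prepares `R` and evaluates the functional `τ` correctly. -/
theorem computes_main (henc : IsLinEnc enc b) (hK : b + 1 ≤ K) {l : List ι} (hne : l ≠ [])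
    (hl : MulSpec K enc zs xs op h l) {R : A} (hR : Computes K fnState zs (enc R))
    {τ : A →L[ℝ] ℂ} (hτ : ∀ M, Computes K fnTrace (.cons zs (enc M)) (.num (τ M)))
    (h1 : τ R = 1) (t : ℂ) :
    Computes (2 * l.length + K + 4) 0
      (Val.ofList [.num t, zs, Val.ofList (l.map fun X => .cons (xs X) (op X))])
      (.num (clusterDeriv (l : Multiset ι) fun lam =>
        Complex.log (τ (NormedSpace.exp (-(Complex.I * t) • linComb h lam) * R)))) := by
  obtain ⟨X, l, rfl⟩ := List.exists_cons_of_ne_nil hne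
  set s : ℂ := -(Complex.I * t) with hs
  set L : (ι → ℝ) → ℂ := fun lam => τ (expTail 0 (s • linComb h lam) * R) with hL
  have hE : AnalyticAt ℝ (fun lam => expTail 0 (s • linComb h lam) * R) 0 :=
    analyticAt_expTail_mul h s R 0
  have hLan : AnalyticAt ℝ L 0 := (τ.analyticAt _).comp hE
  have hL0 : L 0 = 1 := by
    simp only [hL, map_zero, smul_zero, expTail_zero, NormedSpace.exp_zero, one_mul, h1]
  have hslit : L 0 ∈ Complex.slitPlane := by rw [hL0]; exact Complex.one_mem_slitPlane
  have hlog : AnalyticAt ℝ (fun lam => Complex.log (L lam)) 0 :=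
    ((analyticAt_clog hslit).restrictScalars (𝕜 := ℝ)).comp hLan
  have hjet : jet (fun M => Val.num (τ M)) (X :: l) (hornerSum h s R (X :: l).length 0) =
      .cons (jet .num l L) (jet .num l (dir X L)) := by
    rw [← jet_eq_of_vanishesToOrder _ _ hE (analyticAt_hornerSum s R _ _)
      (vanishesToOrder_sub_hornerSum s R _ _), ← jet_clm Val.num τ _ hE, jet]
  simp only [← expTail_zero]
  rw [clusterDeriv_eq hlog (X :: l), List.foldl_cons]
  have h2 : l.foldl (fun g i => dir i g) (dir X fun lam => Complex.log (L lam)) 0 =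
      l.foldl (fun g i => dir i g) (dir X L / L) 0 := by
    have := jet_congr Val.num l (dir_log hLan hslit X)
    have h3 := computes_top l (dir X fun lam => Complex.log (L lam)) _ le_rfl
    rw [this, computes_top l (dir X L / L) _ le_rfl] at h3
    simpa using h3.symm
  rw [h2]
  refine .of_body rfl fun N hN => ?_
  rw [List.length_cons] at hN
  have e1 := hR N (by omega)
  have e2 := henc.computes_const (fun X => .cons (xs X) (op X)) (X :: l) R N
    (by rw [List.length_cons]; omega)
  have e3 := computes_horner henc hK (X :: l) hl s R (fun X => .cons (xs X) (op X)) (X :: l) 0 N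
    (by rw [List.length_cons]; omega)
  have e4 := computes_traceJet hτ (fun X => .cons (xs X) (op X)) (X :: l)
    (hornerSum h s R (X :: l).length 0) N (by rw [List.length_cons]; omega)
  have e5 := computes_divJet l (analyticAt_dir hLan X) hLan (by rw [hL0]; exact one_ne_zero) N
    (by omega)
  have e6 := computes_top l (dir X L / L) N (by omega)
  rw [hjet] at e4
  rw [Nat.cast_zero, zero_add] at e3
  simp only [List.map_cons, ofList_cons, List.length_cons] at e2 e3 e4
  simp [bodyMain, eval, ← hs, e1, e2, e3, e4, e5, e6]

end Echo

/-! ### Spin systems -/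

section Spins

variable {n d : ℕ}

theorem computes_mul_term (hd : Fin n → d ≠ 0) (ρ : Fin n → Matrix (Fin d) (Fin d) ℂ)
    {zs : List (Fin n)} (hz : zs.Nodup) {X : Finset (Fin n)}
    (hX : (X.sort (· ≤ ·)).Sublist zs)
    (B : Matrix (Fin X.card → Fin d) (Fin X.card → Fin d) ℂ) (M : SpinOp n d) :
    Computes (zs.length * (3 * d + 3) + 2) fnMul
      (args (Val.ofList ((X.sort (· ≤ ·)).map encodeSpin)) (encSites ρ zs)
        (encodeOp X.card B) (encT zs M))
      (encT zs (embedOp X B * M)) := by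
  have e : List.ofFn (X.orderEmbOfFin rfl) = X.sort (· ≤ ·) := by
    rw [List.ofFn_eq_map, Finset.listMap_orderEmbOfFin_finRange]
  have h := computes_mul hd ρ zs hz X.card (X.orderEmbOfFin rfl)
    (X.orderEmbOfFin rfl).injective (by rwa [e]) B M
  rw [e, ← embedOp_mul] at h
  exact h

theorem nodup_spinsOf (H : Hamiltonian n d) (l : List H.S) : (spinsOf H l).Nodup :=
  Finset.sort_nodup _ _

theorem sort_sublist_spinsOf {H : Hamiltonian n d} {l : List H.S} {X : H.S} (hX : X ∈ l) :
    (X.1.sort (· ≤ ·)).Sublist (spinsOf H l) := by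
  refine List.sublist_of_subperm_of_pairwise (r := (· ≤ ·))
    (List.subperm_of_subset (Finset.sort_nodup _ _) fun v hv => ?_)
    (Finset.pairwise_sort _ _) (Finset.pairwise_sort _ _)
  simp only [spinsOf, Finset.mem_sort, Finset.mem_biUnion, List.mem_toFinset] at hv ⊢
  exact ⟨X, hX, hv⟩

theorem length_spinsOf_le {H : Hamiltonian n d} {k : ℕ} (hk : H.IsLocal k) (l : List H.S) :
    (spinsOf H l).length ≤ k * l.length := by
  rw [spinsOf, Finset.length_sort]
  calc _ ≤ ∑ X ∈ l.toFinset, X.1.card := Finset.card_biUnion_le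
    _ ≤ ∑ _X ∈ l.toFinset, k := Finset.sum_le_sum fun X _ => hk X.1 X.2
    _ ≤ k * l.length := by
      rw [Finset.sum_const, smul_eq_mul, mul_comm]
      exact Nat.mul_le_mul_left _ (List.toFinset_card_le l)

theorem dim_ne_zero (ρ : ProductState n d) (v : Fin n) : d ≠ 0 := by
  rintro rfl
  simpa [Matrix.trace] using ρ.trace_eq_one v

open scoped Matrix.Norms.Operator in
theorem computes_clusterDeriv (H : Hamiltonian n d) (ρ : ProductState n d) (t : ℂ) {l : List H.S}
    (hl : l ≠ []) :
    Computes (2 * l.length + ((spinsOf H l).length * (3 * d + 4) + 2) + 4) 0 (encodeInput H ρ t l)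
      (.num (clusterDeriv (l : Multiset H.S) fun lam =>
        Complex.log (loschmidtEcho H ρ t lam))) := by
  have hd : Fin n → d ≠ 0 := dim_ne_zero ρ
  have hz := nodup_spinsOf H l
  set zs := spinsOf H l with hzs
  have hle : ∀ a b : ℕ, a ≤ 3 * d + 4 → b ≤ 2 →
      zs.length * a + b ≤ zs.length * (3 * d + 4) + 2 := fun a b ha hb => by gcongr
  have hop : ∀ lam : H.S → ℝ, linComb (fun X : H.S => embedOp X.1 (H.term X)) lam = H.op lam :=
    fun lam => by
      rw [linComb_apply]
      rfl
  have key := computes_main (A := SpinOp n d) (h := fun X : H.S => embedOp X.1 (H.term X))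
    (R := prodOp ρ.site) (τ := (Matrix.traceLinearMap (Fin n → Fin d) ℝ ℂ).toContinuousLinearMap)
    (K := zs.length * (3 * d + 4) + 2)
    (isLinEnc_encT zs) (by
      have := hle (2 * d) 1 (by omega) (by omega)
      omega) hl
    (zs := encSites ρ.site zs)
    (xs := fun X => Val.ofList ((X.1.sort (· ≤ ·)).map encodeSpin))
    (op := fun X => encodeOp X.1.card (H.term X))
    (fun X hX M => (computes_mul_term hd ρ.site hz (sort_sublist_spinsOf hX) (H.term X) M).mono
      (hle _ _ (by omega) le_rfl))
    ((computes_state hd ρ.site zs hz ρ.site ρ.trace_eq_one fun _ _ => rfl).mono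
      (hle _ _ (by omega) (by omega)))
    (fun M => (computes_trace hd ρ.site zs M).mono (hle _ _ (by omega) (by omega)))
    ((trace_prodOp ρ.site).trans (by simp [ρ.trace_eq_one])) t
  simp only [hop] at key
  exact key

end Spins

end ClusterAlgorithm

theorem mainTheorem12 :
    ∃ P : Program, ∀ d k D : ℕ, ∃ C : ℝ,
      ∀ (n : ℕ) (H : Hamiltonian n d) (ρ : ProductState n d) (t : ℂ),
        H.IsLocal k → H.DegreeLE D →
        ∀ m : ℕ, ∀ W ∈ H.connectedClusters m,
        ∀ l : List H.S, (l : Multiset H.S) = W →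
          P.OutputsWithin (encodeInput H ρ t l)
            (Val.num (clusterDeriv W fun lam => Complex.log (loschmidtEcho H ρ t lam)))
            (Real.exp (C * m)) := by
  -- the function bodies have at most `100` nodes, and calls are nested at most
  -- `(k (3 d + 4) + 9) m` deep
  refine ⟨ClusterAlgorithm.prog, fun d k _ => ⟨Real.log 102 * (k * (3 * d + 4) + 9), ?_⟩⟩
  rintro n H ρ t hk - m W ⟨hW0, hm, -⟩ l rfl
  have hl : l ≠ [] := by simpa using hW0
  have hlm : l.length = m := by simpa using hm
  subst hlm
  have hpos : 1 ≤ l.length := List.length_pos_iff.2 hl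
  obtain ⟨c, hc, hle⟩ := ClusterAlgorithm.outputsWithin_of_callFn
    ClusterAlgorithm.size_le_of_mem_prog (ClusterAlgorithm.computes_clusterDeriv H ρ t hl _ le_rfl)
  refine ⟨c, hc, hle.trans ?_⟩
  have h1 := ClusterAlgorithm.length_spinsOf_le hk l
  have h2 : 2 * l.length + ((spinsOf H l).length * (3 * d + 4) + 2) + 4 + 1 ≤
      (k * (3 * d + 4) + 9) * l.length := by
    nlinarith [Nat.mul_le_mul_right (3 * d + 4) h1]
  calc _ ≤ (102 : ℝ) ^ ((k * (3 * d + 4) + 9) * l.length) := by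
        norm_num only [Nat.cast_ofNat]
        exact pow_le_pow_right₀ (by norm_num) h2
    _ = Real.exp (Real.log 102 * (k * (3 * d + 4) + 9) * l.length) := by
        rw [← Real.rpow_natCast, Real.rpow_def_of_pos (by norm_num)]
        push_cast
        ring_nf
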